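/- \textbf{Setting.} Let $X$ be a complex manifold with a holomorphic action of $(\mathbb{C}^*)^k$, and let $\mathbb{C}^k\ltimes X$ be the action groupoid of the induced action of $\mathbb{C}^k$ through the coordinatewise exponential. A \emph{homogeneous groupoid} $(\mathcal{G},i,\pi)$ over $X$ is a source-connected holomorphic Lie groupoid $\mathcal{G}$ over $X$ with source $s$ and target $t$, together with holomorphic groupoid morphisms $i:\mathbb{C}^k\ltimes X\to\mathcal{G}$ (over $\mathrm{id}_X$) and $\pi:\mathcal{G}\to\mathbb{C}^k$ such that $\pi(i(z,x))=z$; such that $i(2\pi i\,n,t(g))\,g=g\,i(2\pi i\,n,s(g))$ for all $n\in\mathbb{Z}^k$ and $g\in\mathcal{G}$; and such that $X$ has exactly one class for the equivalence relation generated by ``the closures of the $\mathcal{G}$-orbits of $x$ and $y$ intersect''. Let $H$ be a connected complex reductive Lie group; semisimple and unipotent elements of $H$, logarithms of unipotent elements and their exponentials are taken in a faithful representation of $H$. An object of $\mathrm{Rep}(\mathcal{G},H)$ is a pair $(P,\phi)$ of a holomorphic right principal $H$-bundle $P\to X$ and a holomorphic groupoid morphism $\phi:\mathcal{G}\to(P\times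 P)/H$ over $\mathrm{id}_X$ to the Atiyah groupoid, i.e. $\phi(g):P_{s(g)}\to P_{t(g)}$ is an $H$-equivariant map; morphisms are principal bundle maps over $\mathrm{id}_X$ which intertwine the representations. The \emph{monodromy} of $\phi$ is $M_n(x)=\phi(i(2\pi i\,n,x))\in\mathrm{Aut}_H(P_x)\cong H$, for $n\in\mathbb{Z}^k$. Let $\mathcal{JC}_H$ be the category of triples $(P,\phi_s,U)$, where $(P,\phi_s)\in\mathrm{Rep}(\mathcal{G},H)$ has semisimple monodromy and $U:\mathbb{Z}^k\to\mathrm{Aut}(\phi_s)$ is a homomorphism with unipotent values; morphisms are principal bundle maps intertwining both the representations and the automorphisms $U_n$. For a homomorphism $V$ from $\mathbb{Z}^k$ to the unipotent automorphisms of a representation on $P$, put \[\sigma_V(g)=\exp\Big(\frac{-1}{2\pi i}\sum_{j=1}^k\pi(g)_j\,\log V_{e_j}(t(g))\Big)\in\mathrm{Aut}_H(P_{t(g)}),\qquad g\in\mathcal{G},\] where $e_1,\dots,e_k$ is the standard basis of $\mathbb{Z}^k$. \textbf{Theorem.} Let $(\mathcal{G},i,\pi)$ be a homogeneous groupoid over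 $X$ and $H$ a connected complex reductive Lie group. There is an isomorphism of categories \[T:\mathrm{Rep}(\mathcal{G},H)\;\cong\;\mathcal{JC}_H\] which is the identity on underlying principal bundles and bundle maps. It is given by $T(P,\phi)=(P,\phi_s,U)$, where $U_n$ is the unipotent component of the monodromy $M_n$ of $\phi$ in the multiplicative Jordan--Chevalley decomposition and $\phi_s=\sigma_U\,\phi$; here $\sigma_U$ is a holomorphic $1$-cocycle valued in $(P,\phi)$, that is, $\sigma_U(gh)=\sigma_U(g)\,\phi(g)\,\sigma_U(h)\,\phi(g)^{-1}$ for composable $g,h$, and the monodromy of $\phi_s$ is the semisimple component of that of $\phi$. The inverse is $T^{-1}(P,\phi_s,U)=(P,\sigma_{U^{-1}}\phi_s)$, where $\sigma_{U^{-1}}$ is a holomorphic $1$-cocycle valued in $(P,\phi_s)$. -/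

import Mathlib

/-!
Holomorphic Lie groupoids, homogeneous groupoids, principal bundles, Atiyah groupoids and
representations.  "Holomorphic" means complex analytic, i.e. `ContMDiff … ω` over `ℂ`.
-/

open CategoryTheory Manifold
open scoped ContDiff Topology

universe w

noncomputable section

namespace JCDec

/-! ### Holomorphic Lie groupoids -/

section Groupoids

variable (E EG X G : Type*)
  [NormedAddCommGroup E] [NormedSpace ℂ E] [NormedAddCommGroup EG] [NormedSpace ℂ EG]
  [TopologicalSpace X] [ChartedSpace E X] [TopologicalSpace G] [ChartedSpace EG G]

/-- A holomorphic Lie groupoid with manifold of objects `X` and (possibly non-Hausdorff) manifold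
of arrows `G`.  The product `mul g h` is meaningful only when `src g = tgt h`; its values on other
pairs are irrelevant and nothing is required of them.  As `src` is a submersion, the composable
pairs form an embedded submanifold of `G × G`, and `ContMDiffOn` on that set is
holomorphy on this submanifold. -/
structure HolLieGroupoid where
  /-- source -/
  src : G → X
  /-- target -/
  tgt : G → X
  /-- identity arrows -/
  one : X → G
  /-- inverse arrows -/
  inv : G → G
  /-- composition `g h` (first `h`, then `g`) -/
  mul : G → G → G
  src_one : ∀ x, src (one x) = x
  tgt_one : ∀ x, tgt (one x) = x
  src_inv : ∀ g, src (inv g) = tgt g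
  tgt_inv : ∀ g, tgt (inv g) = src g
  src_mul : ∀ g h, src g = tgt h → src (mul g h) = src h
  tgt_mul : ∀ g h, src g = tgt h → tgt (mul g h) = tgt g
  mul_assoc : ∀ g h l, src g = tgt h → src h = tgt l → mul (mul g h) l = mul g (mul h l)
  one_mul : ∀ g, mul (one (tgt g)) g = g
  mul_one : ∀ g, mul g (one (src g)) = g
  inv_mul : ∀ g, mul (inv g) g = one (src g)
  mul_inv : ∀ g, mul g (inv g) = one (tgt g)
  src_submersion : IsSubmersion 𝓘(ℂ, EG) 𝓘(ℂ, E) ω src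
  tgt_submersion : IsSubmersion 𝓘(ℂ, EG) 𝓘(ℂ, E) ω tgt
  one_holomorphic : ContMDiff 𝓘(ℂ, E) 𝓘(ℂ, EG) ω one
  inv_holomorphic : ContMDiff 𝓘(ℂ, EG) 𝓘(ℂ, EG) ω inv
  mul_holomorphic : ContMDiffOn (𝓘(ℂ, EG).prod 𝓘(ℂ, EG)) 𝓘(ℂ, EG) ω
    (fun a : G × G => mul a.1 a.2) {a | src a.1 = tgt a.2}

variable {E EG X G}

/-- The orbit of a point of the base. -/
def HolLieGroupoid.orbit (𝒢 : HolLieGroupoid E EG X G) (x : X) : Set X :=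
  {y | ∃ g, 𝒢.src g = x ∧ 𝒢.tgt g = y}

/-- s-equivalence: the equivalence relation generated by "the orbit closures intersect". -/
def HolLieGroupoid.SEquiv (𝒢 : HolLieGroupoid E EG X G) : X → X → Prop :=
  Relation.EqvGen fun x y => (closure (𝒢.orbit x) ∩ closure (𝒢.orbit y)).Nonempty

/-- The coordinatewise exponential `ℂ^k → (ℂ^*)^k`. -/
def expTorus {k : ℕ} (z : Fin k → ℂ) : Fin k → ℂˣ :=
  fun j => Units.mk0 (Complex.exp (z j)) (Complex.exp_ne_zero _)

/-- The lattice vector `2πi n` in the kernel of the exponential. -/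
def lattice {k : ℕ} (n : Fin k → ℤ) : Fin k → ℂ :=
  fun j => 2 * Real.pi * Complex.I * n j

variable (E EG X G)

/-- A homogeneous groupoid over a complex manifold `X` with a holomorphic action of `(ℂ^*)^k`:
a source-connected holomorphic Lie groupoid with morphisms `i : ℂ^k ⋉ X → 𝒢` (over the identity
of `X`) and `π : 𝒢 → ℂ^k` such that `π ∘ i` is the projection, the lattice `2πi ℤ^k × X` is central
in `𝒢`, and there is exactly one s-equivalence class. -/
structure HomogeneousGroupoid (k : ℕ) [MulAction (Fin k → ℂˣ) X]
    extends HolLieGroupoid E EG X G where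
  torus_action_holomorphic :
    ContMDiff ((ModelWithCorners.pi fun _ : Fin k => 𝓘(ℂ, ℂ)).prod 𝓘(ℂ, E)) 𝓘(ℂ, E) ω
      (fun a : (Fin k → ℂˣ) × X => a.1 • a.2)
  source_connected : ∀ x, IsConnected {g | src g = x}
  /-- the morphism `i` out of the action groupoid `ℂ^k ⋉ X` -/
  i : (Fin k → ℂ) × X → G
  i_holomorphic : ContMDiff (𝓘(ℂ, Fin k → ℂ).prod 𝓘(ℂ, E)) 𝓘(ℂ, EG) ω i
  src_i : ∀ z x, src (i (z, x)) = x
  tgt_i : ∀ z x, tgt (i (z, x)) = expTorus z • x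
  i_zero : ∀ x, i (0, x) = one x
  i_add : ∀ z z' x, i (z + z', x) = mul (i (z, expTorus z' • x)) (i (z', x))
  /-- the morphism `π` to the abelian group `ℂ^k` -/
  π : G → (Fin k → ℂ)
  π_holomorphic : ContMDiff 𝓘(ℂ, EG) 𝓘(ℂ, Fin k → ℂ) ω π
  π_mul : ∀ g h, src g = tgt h → π (mul g h) = π g + π h
  π_i : ∀ z x, π (i (z, x)) = z
  central : ∀ (n : Fin k → ℤ) (g : G),
    mul (i (lattice n, tgt g)) g = mul g (i (lattice n, src g))
  nonempty_base : Nonempty X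
  sEquiv_unique : ∀ x y : X, toHolLieGroupoid.SEquiv x y

end Groupoids

/-! ### Complex reductive groups -/

section Reductive

variable (F H : Type*) [NormedAddCommGroup F] [NormedSpace ℂ F]
  [TopologicalSpace H] [ChartedSpace F H] [Group H]

/-- A set of invertible matrices is Zariski closed if it is the zero locus, in the general linear
group, of a set of polynomials in the matrix entries. -/
def IsZariskiClosed {N : ℕ} (Z : Set (GL (Fin N) ℂ)) : Prop :=
  ∃ S : Set (MvPolynomial (Fin N × Fin N) ℂ),
    Z = {A : GL (Fin N) ℂ | ∀ f ∈ S, MvPolynomial.eval (fun a => (A : Matrix (Fin N) (Fin N) ℂ) a.1 a.2) f = 0}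

/-- A unipotent matrix. -/
def IsUnipotentMatrix {N : ℕ} (A : Matrix (Fin N) (Fin N) ℂ) : Prop := IsNilpotent (A - 1)

/-- The structure of a complex reductive group on a complex Lie group `H`: a faithful
representation `ρ` identifying `H` with a Zariski closed complex Lie subgroup of `GL_N(ℂ)`,
such that `H` has trivial unipotent radical. -/
structure ReductiveGroup where
  /-- dimension of the faithful representation -/
  N : ℕ
  /-- the faithful representation -/
  ρ : H →* GL (Fin N) ℂ
  embedding : IsSmoothEmbedding 𝓘(ℂ, F) 𝓘(ℂ, Fin N → Fin N → ℂ) ω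
    (fun h a b => (ρ h : Matrix (Fin N) (Fin N) ℂ) a b)
  zariskiClosed : IsZariskiClosed (Set.range ρ)
  unipotentRadical_trivial : ∀ K : Subgroup H, K.Normal → IsConnected (K : Set H) →
    IsZariskiClosed (ρ '' (K : Set H)) →
    (∀ h ∈ K, IsUnipotentMatrix (ρ h : Matrix (Fin N) (Fin N) ℂ)) → K = ⊥

variable {F H}

namespace ReductiveGroup

variable (R : ReductiveGroup F H)

/-- The matrix of an element of the group in the faithful representation. -/
def mat (h : H) : Matrix (Fin R.N) (Fin R.N) ℂ := (R.ρ h : Matrix (Fin R.N) (Fin R.N) ℂ)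

/-- Semisimple elements (over `ℂ`: the matrix is diagonalizable). -/
def IsSemisimple (h : H) : Prop := Module.End.IsSemisimple (Matrix.toLin' (R.mat h))

/-- Unipotent elements. -/
def IsUnipotent (h : H) : Prop := IsUnipotentMatrix (R.mat h)

/-- `m = s u` is the multiplicative Jordan–Chevalley decomposition of `m`. -/
def IsJordanChevalley (m s u : H) : Prop :=
  R.IsSemisimple s ∧ R.IsUnipotent u ∧ m = s * u ∧ s * u = u * s

/-- The logarithm of a unipotent element, as a matrix: the Taylor series of `log (1 + x)` at
`x = ρ(u) - 1`, whose terms of degree larger than `N` vanish. -/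
def log (u : H) : Matrix (Fin R.N) (Fin R.N) ℂ :=
  ∑ m ∈ Finset.range R.N, ((-1 : ℂ) ^ m / ((m : ℂ) + 1)) • (R.mat u - 1) ^ (m + 1)

/-- `c = exp (-1/(2πi) ∑ⱼ zⱼ log uⱼ)`, read in the faithful representation. -/
def IsExpLog {k : ℕ} (z : Fin k → ℂ) (u : Fin k → H) (c : H) : Prop :=
  R.mat c = NormedSpace.exp
    ((-1 / (2 * Real.pi * Complex.I) : ℂ) • ∑ j, z j • R.log (u j))

end ReductiveGroup

end Reductive

/-! ### Principal bundles -/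

section Bundles

variable (E X F H : Type*)
  [NormedAddCommGroup E] [NormedSpace ℂ E] [NormedAddCommGroup F] [NormedSpace ℂ F]
  [TopologicalSpace X] [ChartedSpace E X] [TopologicalSpace H] [ChartedSpace F H] [Group H]

/-- A holomorphic right principal `H`-bundle over `X`. -/
structure PrincipalBundle where
  /-- total space -/
  carrier : Type w
  [topology : TopologicalSpace carrier]
  [charted : ChartedSpace (ModelProd E F) carrier]
  [manifold : IsManifold (𝓘(ℂ, E).prod 𝓘(ℂ, F)) ω carrier]
  /-- bundle projection -/
  proj : carrier → X
  /-- right action of `H` -/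
  act : carrier → H → carrier
  act_one : ∀ p, act p 1 = p
  act_mul : ∀ p h h', act p (h * h') = act (act p h) h'
  proj_act : ∀ p h, proj (act p h) = proj p
  proj_holomorphic : ContMDiff (𝓘(ℂ, E).prod 𝓘(ℂ, F)) 𝓘(ℂ, E) ω proj
  act_holomorphic : ContMDiff ((𝓘(ℂ, E).prod 𝓘(ℂ, F)).prod 𝓘(ℂ, F)) (𝓘(ℂ, E).prod 𝓘(ℂ, F)) ω
    (fun a : carrier × H => act a.1 a.2)
  /-- equivariant biholomorphic local trivializations -/
  locally_trivial : ∀ x : X, ∃ W : Set X, IsOpen W ∧ x ∈ W ∧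
    ∃ e : OpenPartialHomeomorph carrier (X × H),
      e.source = proj ⁻¹' W ∧ e.target = W ×ˢ Set.univ ∧
      (∀ p ∈ e.source, (e p).1 = proj p) ∧
      (∀ p ∈ e.source, ∀ h, (e (act p h)).2 = (e p).2 * h) ∧
      ContMDiffOn (𝓘(ℂ, E).prod 𝓘(ℂ, F)) (𝓘(ℂ, E).prod 𝓘(ℂ, F)) ω e e.source ∧
      ContMDiffOn (𝓘(ℂ, E).prod 𝓘(ℂ, F)) (𝓘(ℂ, E).prod 𝓘(ℂ, F)) ω e.symm e.target

attribute [instance] PrincipalBundle.topology PrincipalBundle.charted PrincipalBundle.manifold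

variable {E X F H}

namespace PrincipalBundle

/-- Principal bundle maps: holomorphic `H`-equivariant maps over the identity of `X`. -/
@[ext]
structure Hom (P Q : PrincipalBundle.{w} E X F H) where
  /-- underlying map of total spaces -/
  toFun : P.carrier → Q.carrier
  holomorphic : ContMDiff (𝓘(ℂ, E).prod 𝓘(ℂ, F)) (𝓘(ℂ, E).prod 𝓘(ℂ, F)) ω toFun
  proj_toFun : ∀ p, Q.proj (toFun p) = P.proj p
  toFun_act : ∀ p h, toFun (P.act p h) = Q.act (toFun p) h

instance : Category (PrincipalBundle.{w} E X F H) where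
  Hom := Hom
  id P := ⟨id, contMDiff_id, fun _ => rfl, fun _ _ => rfl⟩
  comp f g := ⟨g.toFun ∘ f.toFun, g.holomorphic.comp f.holomorphic,
    fun p => (g.proj_toFun _).trans (f.proj_toFun p),
    fun p h => by simp [f.toFun_act, g.toFun_act]⟩

/-- The diagonal action of `H` on `P × P`, as an equivalence relation. -/
def pairSetoid (P : PrincipalBundle.{w} E X F H) : Setoid (P.carrier × P.carrier) where
  r a b := ∃ h : H, b = (P.act a.1 h, P.act a.2 h)
  iseqv :=
    { refl := fun a => ⟨1, by simp [P.act_one]⟩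
      symm := by
        rintro a b ⟨h, rfl⟩
        exact ⟨h⁻¹, by simp [← P.act_mul, P.act_one]⟩
      trans := by
        rintro a b c ⟨h, rfl⟩ ⟨h', rfl⟩
        exact ⟨h * h', by simp [P.act_mul]⟩ }

/-- The Atiyah groupoid `Pair(P)/H` of a principal bundle. -/
def Atiyah (P : PrincipalBundle.{w} E X F H) : Type w := Quotient P.pairSetoid

/-- The class `[q, p]` in the Atiyah groupoid: the `H`-equivariant map from the fibre
through `p` to the fibre through `q` that sends `p` to `q`. -/
def arrow (P : PrincipalBundle.{w} E X F H) (q p : P.carrier) : P.Atiyah :=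
  Quotient.mk P.pairSetoid (q, p)

namespace Atiyah

variable {P : PrincipalBundle.{w} E X F H}

/-- Source in the Atiyah groupoid. -/
def src (a : P.Atiyah) : X :=
  Quotient.liftOn a (fun b => P.proj b.2) (by rintro a b ⟨h, rfl⟩; simp [P.proj_act])

/-- Target in the Atiyah groupoid. -/
def tgt (a : P.Atiyah) : X :=
  Quotient.liftOn a (fun b => P.proj b.1) (by rintro a b ⟨h, rfl⟩; simp [P.proj_act])

/-- Inverse in the Atiyah groupoid. -/
def inv (a : P.Atiyah) : P.Atiyah :=
  Quotient.liftOn a (fun b => P.arrow b.2 b.1)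
    (by rintro a b ⟨h, rfl⟩; exact Quotient.sound ⟨h, rfl⟩)

/-- `IsComp a b c` says that `a` and `b` are composable with composite `a ∘ b = c`:
`[r, q] ∘ [q, p] = [r, p]`. -/
def IsComp (a b c : P.Atiyah) : Prop :=
  ∃ p q r, a = P.arrow r q ∧ b = P.arrow q p ∧ c = P.arrow r p

/-- Holomorphy of a map into the Atiyah groupoid.  As `P × P → Pair(P)/H` is a holomorphic
principal bundle, a map into the quotient is holomorphic exactly when it lifts locally to a
holomorphic map into `P × P`. -/
def IsHolomorphic (EG : Type*) {G : Type*} [NormedAddCommGroup EG] [NormedSpace ℂ EG]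
    [TopologicalSpace G] [ChartedSpace EG G] (f : G → P.Atiyah) : Prop :=
  ∀ g₀ : G, ∃ W : Set G, IsOpen W ∧ g₀ ∈ W ∧ ∃ a b : G → P.carrier,
    ContMDiffOn 𝓘(ℂ, EG) (𝓘(ℂ, E).prod 𝓘(ℂ, F)) ω a W ∧
    ContMDiffOn 𝓘(ℂ, EG) (𝓘(ℂ, E).prod 𝓘(ℂ, F)) ω b W ∧
    ∀ g ∈ W, f g = P.arrow (a g) (b g)

end Atiyah

end PrincipalBundle

/-! ### Representations -/

variable {EG G : Type*} [NormedAddCommGroup EG] [NormedSpace ℂ EG]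
  [TopologicalSpace G] [ChartedSpace EG G]

/-- A representation of `𝒢` on `P`: a homomorphism of holomorphic groupoids (over the identity
of `X`) from `𝒢` to the Atiyah groupoid of `P`. -/
@[ext]
structure RepOn (𝒢 : HolLieGroupoid E EG X G) (P : PrincipalBundle.{w} E X F H) where
  /-- underlying map of arrows -/
  toFun : G → P.Atiyah
  src_toFun : ∀ g, (toFun g).src = 𝒢.src g
  tgt_toFun : ∀ g, (toFun g).tgt = 𝒢.tgt g
  map_one : ∀ p, toFun (𝒢.one (P.proj p)) = P.arrow p p
  map_mul : ∀ g h, 𝒢.src g = 𝒢.tgt h → (toFun g).IsComp (toFun h) (toFun (𝒢.mul g h))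
  holomorphic : PrincipalBundle.Atiyah.IsHolomorphic EG toFun

/-- A 1-cocycle valued in the representation `φ`: a holomorphic section `σ` of the pullback by
the target map of the gauge groupoid (the isotropy of the Atiyah groupoid) with
`σ(gh) = σ(g) φ(g) σ(h) φ(g)⁻¹`. -/
structure IsOneCocycle {𝒢 : HolLieGroupoid E EG X G} {P : PrincipalBundle.{w} E X F H}
    (φ : RepOn 𝒢 P) (σ : G → P.Atiyah) : Prop where
  src_eq : ∀ g, (σ g).src = 𝒢.tgt g
  tgt_eq : ∀ g, (σ g).tgt = 𝒢.tgt g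
  holomorphic : PrincipalBundle.Atiyah.IsHolomorphic EG σ
  cocycle : ∀ g h, 𝒢.src g = 𝒢.tgt h → ∃ a b : P.Atiyah,
    (σ g).IsComp (φ.toFun g) a ∧ a.IsComp (σ h) b ∧
      b.IsComp (φ.toFun g).inv (σ (𝒢.mul g h))

variable (F H) in
/-- Objects of the category `Rep(𝒢, H)`. -/
structure GRep (𝒢 : HolLieGroupoid E EG X G) where
  /-- the principal bundle -/
  P : PrincipalBundle.{w} E X F H
  /-- the representation on it -/
  φ : RepOn 𝒢 P

namespace GRep

variable {𝒢 : HolLieGroupoid E EG X G}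

/-- Morphisms of representations: principal bundle maps intertwining the representations. -/
@[ext]
structure Hom (A B : GRep.{w} F H 𝒢) where
  /-- underlying bundle map -/
  map : A.P ⟶ B.P
  intertwines : ∀ g q p, A.φ.toFun g = A.P.arrow q p →
    B.φ.toFun g = B.P.arrow (map.toFun q) (map.toFun p)

instance : Category (GRep.{w} F H 𝒢) where
  Hom := Hom
  id A := ⟨𝟙 A.P, fun _ _ _ h => h⟩
  comp f g := ⟨f.map ≫ g.map, fun a q p h => g.intertwines a _ _ (f.intertwines a q p h)⟩

/-- The functor that remembers only the principal bundle. -/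
def forget : GRep.{w} F H 𝒢 ⥤ PrincipalBundle.{w} E X F H where
  obj A := A.P
  map f := f.map

/-- The map of total spaces underlying an automorphism of a representation. -/
def autFun {A : GRep.{w} F H 𝒢} (u : Aut A) : A.P.carrier → A.P.carrier :=
  u.hom.map.toFun

end GRep

/-! ### The category of Jordan–Chevalley triples -/

variable {k : ℕ} [MulAction (Fin k → ℂˣ) X]

/-- The monodromy `M_n(x) = φ(i(2πi n, x))`, in the isotropy of the Atiyah groupoid at `x`. -/
def monodromy (𝒢 : HomogeneousGroupoid E EG X G k) {P : PrincipalBundle.{w} E X F H}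
    (φ : RepOn 𝒢.toHolLieGroupoid P) (n : Fin k → ℤ) (x : X) : P.Atiyah :=
  φ.toFun (𝒢.i (lattice n, x))

/-- The gauge transformation `M_n` is semisimple at every point, for every `n`. In the frame `p`
the element `[p·m, p]` of the gauge groupoid is `m ∈ H`. -/
def HasSemisimpleMonodromy (𝒢 : HomogeneousGroupoid E EG X G k) (R : ReductiveGroup F H)
    {P : PrincipalBundle.{w} E X F H} (φ : RepOn 𝒢.toHolLieGroupoid P) : Prop :=
  ∀ (n : Fin k → ℤ) (p : P.carrier) (m : H),
    monodromy 𝒢 φ n (P.proj p) = P.arrow (P.act p m) p → R.IsSemisimple m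

/-- A unipotent automorphism of a representation. -/
def IsUnipotentAut {𝒢 : HolLieGroupoid E EG X G} (R : ReductiveGroup F H)
    {A : GRep.{w} F H 𝒢} (u : Aut A) : Prop :=
  ∀ (p : A.P.carrier) (h : H), GRep.autFun u p = A.P.act p h → R.IsUnipotent h

/-- Objects `(P, φ_s, U)` of the category `JC_H`. -/
structure JC (𝒢 : HomogeneousGroupoid E EG X G k) (R : ReductiveGroup F H) where
  /-- the representation `(P, φ_s)` -/
  rep : GRep.{w} F H 𝒢.toHolLieGroupoid
  semisimple : HasSemisimpleMonodromy 𝒢 R rep.φ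
  /-- the homomorphism `U : ℤ^k → Aut(φ_s)` -/
  U : Multiplicative (Fin k → ℤ) →* Aut rep
  unipotent : ∀ n, IsUnipotentAut R (U n)

namespace JC

variable {𝒢 : HomogeneousGroupoid E EG X G k} {R : ReductiveGroup F H}

/-- Morphisms of `JC_H`: bundle maps intertwining the representations and the unipotent
automorphisms. -/
@[ext]
structure Hom (A B : JC.{w} 𝒢 R) where
  /-- underlying morphism of representations -/
  map : A.rep ⟶ B.rep
  intertwines : ∀ n, (A.U n).hom ≫ map = map ≫ (B.U n).hom

instance : Category (JC.{w} 𝒢 R) where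
  Hom := Hom
  id A := ⟨𝟙 A.rep, fun n => by simp⟩
  comp f g := ⟨f.map ≫ g.map, fun n => by
    rw [← Category.assoc, f.intertwines, Category.assoc, g.intertwines, Category.assoc]⟩

/-- The functor that remembers only the principal bundle. -/
def forget : JC.{w} 𝒢 R ⥤ PrincipalBundle.{w} E X F H where
  obj A := A.rep.P
  map f := f.map.map

end JC

/-- `σ` is the section `σ_V(g) = exp (-1/(2πi) ∑ⱼ π(g)ⱼ log V_{eⱼ}(t(g)))` attached to a family
`V` of unipotent gauge transformations indexed by `ℤ^k`.  It is read in frames: if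
`V_{eⱼ}(q) = q·uⱼ` then `σ_V(g) = [q·c, q]` with `c = exp (-1/(2πi) ∑ⱼ π(g)ⱼ log uⱼ)`. -/
def IsUnipotentSection (𝒢 : HomogeneousGroupoid E EG X G k) (R : ReductiveGroup F H)
    (P : PrincipalBundle.{w} E X F H) (V : (Fin k → ℤ) → P.carrier → P.carrier)
    (σ : G → P.Atiyah) : Prop :=
  ∀ (g : G) (q : P.carrier), P.proj q = 𝒢.tgt g →
    ∃ (u : Fin k → H) (c : H), (∀ j, V (Pi.single j 1) q = P.act q (u j)) ∧
      R.IsExpLog (𝒢.π g) u c ∧ σ g = P.arrow (P.act q c) q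

/-- `ψ = σ_V φ`, where `σ_V` is a 1-cocycle valued in `φ`. -/
def IsTwist (𝒢 : HomogeneousGroupoid E EG X G k) (R : ReductiveGroup F H)
    {P : PrincipalBundle.{w} E X F H} (V : (Fin k → ℤ) → P.carrier → P.carrier)
    (φ ψ : RepOn 𝒢.toHolLieGroupoid P) : Prop :=
  ∃ σ : G → P.Atiyah, IsOneCocycle φ σ ∧ IsUnipotentSection 𝒢 R P V σ ∧
    ∀ g, (σ g).IsComp (φ.toFun g) (ψ.toFun g)

end Bundles

end JCDec

end

open JCDec

/-!
The element `i (2πi n, x)` is central in the isotropy of `𝒢`, so the monodromy `M_n` of a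
representation is an invariant automorphism, and the coefficients of its characteristic polynomial
are continuous functions, constant on `𝒢`-orbits. As `X` has a single class for the equivalence
relation generated by intersecting orbit closures, they are constant. Hence one polynomial computes
the semisimple component of `M_n` at every point, and both Jordan components of the monodromy are
holomorphic and invariant under the representation.

Since the unipotent components `U_n` are invariant and commute, the section
`g ↦ exp (-(2πi)⁻¹ ∑ j, π(g)_j log U_{e_j})` is a `1`-cocycle; at `i (2πi n, x)` it equals `U_n⁻¹`,
so that multiplying by it removes exactly the unipotent component of the monodromy.

That Jordan components and exponentials of logarithms stay in the algebraic subgroup `H` is a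
density argument: a Zariski closed set containing `(su)^n` for all `n ∈ ℕ` contains
`s^a exp (b log u)` for all `a ∈ ℕ` and `b ∈ ℂ`, because `μ ^ n * q(n) = 0` for all `n` is only
possible for `q = 0`, and the sequences `μ ^ n * q(n)` with distinct `μ` are independent.
-/

noncomputable section

namespace JCDec

open Polynomial hiding smul_pow

section Aeval

variable {K A : Type*} [CommRing K] [Ring A] [Algebra K A]

theorem commute_aeval_right {x y : A} (h : Commute x y) (p : K[X]) : Commute x (aeval y p) :=
  Algebra.commute_of_mem_adjoin_singleton_of_commute (aeval_mem_adjoin_singleton K y) h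

theorem commute_aeval_aeval {x y : A} (h : Commute x y) (p q : K[X]) :
    Commute (aeval x p) (aeval y q) :=
  commute_aeval_right (commute_aeval_right h.symm p).symm q

theorem aeval_units_conj (u : Aˣ) (x : A) (p : K[X]) :
    aeval (↑u * x * ↑u⁻¹) p = ↑u * aeval x p * ↑u⁻¹ := by
  simpa only [ConjAct.units_smul_def, ConjAct.ofConjAct_toConjAct] using
    aeval_smul p (ConjAct.toConjAct u) x

end Aeval

section Exponential

theorem exp_eq_sum_range_of_pow_eq_zero {K A : Type*} [Field K] [CharZero K] [Ring A] [Algebra K A]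
    [TopologicalSpace A] [IsTopologicalRing A] {a : A} {N : ℕ} (ha : a ^ N = 0) :
    NormedSpace.exp a = ∑ m ∈ Finset.range N, (m.factorial : K)⁻¹ • a ^ m := by
  rw [NormedSpace.exp_eq_tsum K]
  refine tsum_eq_sum fun m hm => ?_
  rw [pow_eq_zero_of_le (by simpa using hm) ha, smul_zero]

theorem exp_sub_one_pow_eq_zero {K A : Type*} [Field K] [CharZero K] [Ring A] [Algebra K A]
    [TopologicalSpace A] [IsTopologicalRing A] {a : A} {N : ℕ} (ha : a ^ N = 0) :
    (NormedSpace.exp a - 1) ^ N = 0 := by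
  set b : A := ∑ m ∈ Finset.range N, ((m + 1).factorial : K)⁻¹ • a ^ m
  have hab : Commute a b :=
    Commute.sum_right _ _ _ fun m _ => ((Commute.refl a).pow_right m).smul_right _
  have hexp : NormedSpace.exp a - 1 = a * b := by
    rw [exp_eq_sum_range_of_pow_eq_zero (K := K) (pow_eq_zero_of_le N.le_succ ha),
      Finset.sum_range_succ', Finset.mul_sum]
    simp [pow_succ']
  rw [hexp, hab.mul_pow, ha, zero_mul]

variable {𝕂 𝔸 : Type*} [RCLike 𝕂] [NormedRing 𝔸] [NormedAlgebra 𝕂 𝔸]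

theorem hasDerivAt_exp_of_commute [CompleteSpace 𝔸] {c : 𝕂 → 𝔸} {c' : 𝔸} {t : 𝕂}
    (hc : HasDerivAt c c' t) (hcomm : ∀ s, Commute (c t) (c s)) :
    HasDerivAt (fun s => NormedSpace.exp (c s)) (NormedSpace.exp (c t) * c') t := by
  let _ : NormedAlgebra ℚ 𝔸 := NormedAlgebra.restrictScalars ℚ 𝕂 𝔸
  have hfactor (s : 𝕂) :
      NormedSpace.exp (c s) = NormedSpace.exp (c t) * NormedSpace.exp (c s - c t) := by
    rw [← NormedSpace.exp_add_of_commute ((hcomm s).sub_right (Commute.refl _)), add_sub_cancel]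
  have hexp : HasFDerivAt (NormedSpace.exp : 𝔸 → 𝔸) (1 : 𝔸 →L[𝕂] 𝔸) (c t - c t) := by
    rw [sub_self]; exact hasFDerivAt_exp_zero
  exact ((hexp.comp_hasDerivAt t (hc.sub_const (c t))).const_mul _).congr_of_eventuallyEq
    (.of_forall hfactor)

theorem hasDerivAt_aeval_of_commute {c : 𝕂 → 𝔸} {c' : 𝔸} {t : 𝕂} (hc : HasDerivAt c c' t)
    (hcomm : Commute c' (c t)) (p : 𝕂[X]) :
    HasDerivAt (fun s => aeval (c s) p) (c' * aeval (c t) (derivative p)) t := by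
  induction p using Polynomial.induction_on' with
  | add p q hp hq =>
    simpa only [map_add, mul_add] using hp.fun_add hq
  | monomial n a =>
    have hpow := (hc.fun_pow' n).fun_const_smul a
    have hsum : ∑ i ∈ Finset.range n, c t ^ (n.pred - i) * c' * c t ^ i =
        (n : 𝕂) • (c' * c t ^ (n - 1)) := by
      rw [Finset.sum_congr rfl fun i hi => ?_, Finset.sum_const, Finset.card_range,
        Nat.cast_smul_eq_nsmul]
      rw [← (hcomm.pow_right _).eq, mul_assoc, ← pow_add, Nat.pred_eq_sub_one,
        Nat.sub_add_cancel (Nat.le_sub_one_of_lt (Finset.mem_range.mp hi))]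
    rw [hsum, smul_smul] at hpow
    simpa only [derivative_monomial, aeval_monomial, ← Algebra.smul_def, mul_smul_comm] using hpow

variable (𝕂) in
/-- The Taylor polynomial of degree `N` of `log (1 + X)` at the origin. -/
def logTaylor (N : ℕ) : 𝕂[X] :=
  ∑ m ∈ Finset.range N, monomial (m + 1) ((-1) ^ m / ((m : 𝕂) + 1))

theorem aeval_logTaylor {A : Type*} [Ring A] [Algebra 𝕂 A] (x : A) (N : ℕ) :
    aeval x (logTaylor 𝕂 N) =
      ∑ m ∈ Finset.range N, ((-1) ^ m / ((m : 𝕂) + 1)) • x ^ (m + 1) := by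
  simp only [logTaylor, map_sum, aeval_monomial, Algebra.smul_def]

theorem derivative_logTaylor_mul (N : ℕ) :
    derivative (logTaylor 𝕂 N) * (1 + X) = 1 - (-X) ^ N := by
  have hgeom : derivative (logTaylor 𝕂 N) = ∑ m ∈ Finset.range N, (-X) ^ m := by
    rw [logTaylor, map_sum]
    refine Finset.sum_congr rfl fun m _ => ?_
    have hm : (m : 𝕂) + 1 ≠ 0 := m.cast_add_one_ne_zero
    rw [derivative_monomial, Nat.cast_succ, div_mul_cancel₀ _ hm, Nat.add_sub_cancel,
      neg_pow (X : 𝕂[X]), ← C_mul_X_pow_eq_monomial, map_pow, map_neg, map_one]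
  rw [hgeom, ← sub_neg_eq_add 1 X, geom_sum_mul_neg]

theorem aeval_derivative_logTaylor_mul {A : Type*} [Ring A] [Algebra 𝕂 A] {x : A} {N : ℕ}
    (hx : x ^ N = 0) : aeval x (derivative (logTaylor 𝕂 N)) * (1 + x) = 1 := by
  have h := congrArg (aeval x) (derivative_logTaylor_mul (𝕂 := 𝕂) N)
  simpa [neg_pow x, hx] using h

theorem isNilpotent_aeval_logTaylor {A : Type*} [Ring A] [Algebra 𝕂 A] {x : A}
    (hx : IsNilpotent x) (N : ℕ) : IsNilpotent (aeval x (logTaylor 𝕂 N)) := by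
  rw [aeval_logTaylor]
  refine Commute.isNilpotent_sum (fun m _ => (hx.pow_of_pos m.succ_ne_zero).smul _)
    fun _ _ _ _ => ?_
  exact (((Commute.refl x).pow_pow _ _).smul_left _).smul_right _

theorem exp_aeval_logTaylor [CompleteSpace 𝔸] {x : 𝔸} {N : ℕ} (hx : x ^ N = 0) :
    NormedSpace.exp (aeval x (logTaylor 𝕂 N)) = 1 + x := by
  let _ : NormedAlgebra ℚ 𝔸 := NormedAlgebra.restrictScalars ℚ 𝕂 𝔸
  set L : 𝕂 → 𝔸 := fun t => aeval (t • x) (logTaylor 𝕂 N)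
  have hline (t : 𝕂) : HasDerivAt (fun s : 𝕂 => s • x) x t := by
    simpa using (hasDerivAt_id t).smul_const x
  have hLcomm (s t : 𝕂) : Commute (L s) (L t) :=
    commute_aeval_aeval (((Commute.refl x).smul_left s).smul_right t) _ _
  have hLderiv (t : 𝕂) := hasDerivAt_aeval_of_commute (hline t) ((Commute.refl x).smul_right t)
    (logTaylor 𝕂 N)
  have hderiv (t : 𝕂) : HasDerivAt (fun t => NormedSpace.exp (-L t) * (1 + t • x)) 0 t := by
    have h := (hasDerivAt_exp_of_commute (hLderiv t).neg
      fun s => (hLcomm t s).neg_left.neg_right).mul ((hline t).const_add 1)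
    have htx : (t • x) ^ N = 0 := by rw [smul_pow, hx, smul_zero]
    rwa [mul_assoc, neg_mul, mul_assoc, aeval_derivative_logTaylor_mul htx, mul_one, mul_neg,
      neg_add_cancel] at h
  have hconst : NormedSpace.exp (-L 1) * (1 + x) = 1 := by
    have h := is_const_of_deriv_eq_zero (fun t => (hderiv t).differentiableAt)
      (fun t => (hderiv t).deriv) 1 0
    simpa [L, aeval_logTaylor] using h
  have hinv : NormedSpace.exp (L 1) * NormedSpace.exp (-L 1) = 1 := by
    rw [← NormedSpace.exp_add_of_commute (Commute.refl _).neg_right, add_neg_cancel,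
      NormedSpace.exp_zero]
  simpa [L] using left_inv_eq_right_inv hinv hconst

theorem aeval_logTaylor_exp_sub_one [CompleteSpace 𝔸] {a : 𝔸} {N : ℕ} (ha : a ^ N = 0) :
    aeval (NormedSpace.exp a - 1) (logTaylor 𝕂 N) = a := by
  set E : 𝕂 → 𝔸 := fun t => NormedSpace.exp (t • a)
  have hE (t : 𝕂) : HasDerivAt (fun t => E t - 1) (a * E t) t :=
    (hasDerivAt_exp_smul_const' a t).sub_const 1
  have hcomm (t : 𝕂) : Commute a (E t) := ((Commute.refl a).smul_right t).exp_right
  have hderiv (t : 𝕂) :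
      HasDerivAt (fun t => aeval (E t - 1) (logTaylor 𝕂 N) - t • a) 0 t := by
    have hpow : (E t - 1) ^ N = 0 :=
      exp_sub_one_pow_eq_zero (K := 𝕂) (by rw [smul_pow, ha, smul_zero])
    have hlog := aeval_derivative_logTaylor_mul (𝕂 := 𝕂) hpow
    rw [add_sub_cancel, ← (commute_aeval_right ((Commute.refl _).sub_right (Commute.one_right _))
      _).eq] at hlog
    have h := (hasDerivAt_aeval_of_commute (hE t)
      (((hcomm t).mul_left (Commute.refl _)).sub_right (Commute.one_right _))
      (logTaylor 𝕂 N)).sub ((hasDerivAt_id t).smul_const a)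
    rwa [mul_assoc, hlog, mul_one, one_smul, sub_self] at h
  have h := is_const_of_deriv_eq_zero (fun t => (hderiv t).differentiableAt)
    (fun t => (hderiv t).deriv) 1 0
  simpa [E, aeval_logTaylor, sub_eq_zero] using h

end Exponential

section UnipotentMatrices

open scoped Matrix.Norms.Operator

theorem pow_eq_zero_of_isNilpotent {n R : Type*} [Fintype n] [DecidableEq n] [CommRing R]
    [IsDomain R] {A : Matrix n n R} (hA : IsNilpotent A) : A ^ Fintype.card n = 0 := by
  have hχ : A.charpoly = X ^ Fintype.card n :=
    sub_eq_zero.mp (Matrix.isNilpotent_charpoly_sub_pow_of_isNilpotent hA).eq_zero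
  simpa only [hχ, map_pow, aeval_X] using A.aeval_self_charpoly

variable {N : ℕ} {A B : Matrix (Fin N) (Fin N) ℂ}

theorem IsUnipotentMatrix.sub_one_pow_eq_zero (hA : IsUnipotentMatrix A) : (A - 1) ^ N = 0 := by
  simpa only [Fintype.card_fin] using pow_eq_zero_of_isNilpotent hA

theorem isUnipotentMatrix_exp (hA : IsNilpotent A) : IsUnipotentMatrix (NormedSpace.exp A) :=
  let ⟨m, hm⟩ := hA
  ⟨m, exp_sub_one_pow_eq_zero (K := ℂ) hm⟩

/-- The logarithm of a unipotent matrix. -/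
def unipotentLog (A : Matrix (Fin N) (Fin N) ℂ) : Matrix (Fin N) (Fin N) ℂ :=
  aeval (A - 1) (logTaylor ℂ N)

theorem isNilpotent_unipotentLog (hA : IsUnipotentMatrix A) : IsNilpotent (unipotentLog A) :=
  isNilpotent_aeval_logTaylor hA N

theorem exp_unipotentLog (hA : IsUnipotentMatrix A) : NormedSpace.exp (unipotentLog A) = A :=
  (exp_aeval_logTaylor hA.sub_one_pow_eq_zero).trans (add_sub_cancel 1 A)

theorem unipotentLog_exp (hA : IsNilpotent A) : unipotentLog (NormedSpace.exp A) = A :=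
  aeval_logTaylor_exp_sub_one (by simpa only [Fintype.card_fin] using pow_eq_zero_of_isNilpotent hA)

theorem commute_unipotentLog_right (h : Commute A B) : Commute A (unipotentLog B) :=
  commute_aeval_right (h.sub_right (Commute.one_right _)) _

theorem commute_unipotentLog (h : Commute A B) : Commute (unipotentLog A) (unipotentLog B) :=
  commute_unipotentLog_right (commute_unipotentLog_right h.symm).symm

theorem unipotentLog_units_conj (u : (Matrix (Fin N) (Fin N) ℂ)ˣ)
    (A : Matrix (Fin N) (Fin N) ℂ) :
    unipotentLog (u.val * A * u⁻¹.val) = u.val * unipotentLog A * u⁻¹.val := by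
  rw [unipotentLog, unipotentLog, ← aeval_units_conj, mul_sub, sub_mul, mul_one, u.mul_inv]

theorem IsUnipotentMatrix.mul (hA : IsUnipotentMatrix A) (hB : IsUnipotentMatrix B)
    (h : Commute A B) : IsUnipotentMatrix (A * B) := by
  have hlog := commute_unipotentLog h
  rw [← exp_unipotentLog hA, ← exp_unipotentLog hB, ← Matrix.exp_add_of_commute _ _ hlog]
  exact isUnipotentMatrix_exp
    (hlog.isNilpotent_add (isNilpotent_unipotentLog hA) (isNilpotent_unipotentLog hB))

theorem IsUnipotentMatrix.inv_eq_exp (hA : IsUnipotentMatrix A) :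
    A⁻¹ = NormedSpace.exp (-unipotentLog A) := by
  rw [Matrix.exp_neg, exp_unipotentLog hA]

theorem IsUnipotentMatrix.inv (hA : IsUnipotentMatrix A) : IsUnipotentMatrix A⁻¹ :=
  hA.inv_eq_exp ▸ isUnipotentMatrix_exp (isNilpotent_unipotentLog hA).neg

theorem unipotentLog_inv (hA : IsUnipotentMatrix A) : unipotentLog A⁻¹ = -unipotentLog A := by
  rw [hA.inv_eq_exp, unipotentLog_exp (isNilpotent_unipotentLog hA).neg]

end UnipotentMatrices

section JordanChevalley

variable {K : Type*} [Field K] [PerfectField K]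

/-- Newton's method in `K[X] ⧸ χ` approximates the class of `X`, modulo nilpotents, by a root of
the radical `P` of `χ`. -/
theorem exists_dvd_comp_and_dvd_X_sub_pow {χ : K[X]} (hχ : χ ≠ 0) :
    ∃ P q : K[X], ∃ j, Squarefree P ∧ χ ∣ P.comp q ∧ χ ∣ (X - q) ^ j := by
  obtain ⟨P, k, hP, -, hχP⟩ := exists_squarefree_dvd_pow_of_ne_zero hχ
  have hnil : IsNilpotent (aeval (AdjoinRoot.root χ) P) := by
    refine ⟨k, ?_⟩
    rwa [← map_pow, AdjoinRoot.aeval_eq, AdjoinRoot.mk_eq_zero]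
  have hunit : IsUnit (aeval (AdjoinRoot.root χ) (derivative P)) := by
    obtain ⟨a, b, hab⟩ := PerfectField.separable_iff_squarefree.mpr hP
    have hab := congrArg (aeval (AdjoinRoot.root χ)) hab
    rw [map_add, map_mul, map_mul, map_one, ← eq_sub_iff_add_eq'] at hab
    refine isUnit_of_mul_isUnit_right (x := aeval (AdjoinRoot.root χ) b) ?_
    rw [hab]
    exact ((Commute.all _ _).isNilpotent_mul_left hnil).isUnit_one_sub
  obtain ⟨r, ⟨⟨j, hj⟩, hr⟩, -⟩ := existsUnique_nilpotent_sub_and_aeval_eq_zero hnil hunit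
  obtain ⟨q, rfl⟩ := AdjoinRoot.mk_surjective r
  refine ⟨P, q, j, hP, ?_, ?_⟩
  · rwa [← AdjoinRoot.mk_eq_zero, ← AdjoinRoot.aeval_eq, aeval_comp, AdjoinRoot.aeval_eq]
  · rwa [← AdjoinRoot.mk_eq_zero, map_pow, map_sub, AdjoinRoot.mk_X]

theorem exists_aeval_isSemisimple_and_isNilpotent_sub {n : Type*} [Fintype n] [DecidableEq n]
    {χ : K[X]} (hχ : χ ≠ 0) :
    ∃ q : K[X], ∀ A : Matrix n n K, aeval A χ = 0 →
      Module.End.IsSemisimple (Matrix.toLin' (aeval A q)) ∧ IsNilpotent (A - aeval A q) := by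
  obtain ⟨P, q, j, hP, hcomp, hpow⟩ := exists_dvd_comp_and_dvd_X_sub_pow hχ
  have hzero {p : K[X]} {A : Matrix n n K} (hA : aeval A χ = 0) (hp : χ ∣ p) : aeval A p = 0 :=
    zero_dvd_iff.mp (hA ▸ map_dvd (aeval A) hp)
  refine ⟨q, fun A hA => ⟨?_, j, ?_⟩⟩
  · refine Module.End.isSemisimple_of_squarefree_aeval_eq_zero hP ?_
    have h : aeval (Matrix.toLinAlgEquiv' (aeval A q)) P = 0 := by
      rw [aeval_algHom_apply, ← aeval_comp, hzero hA hcomp, map_zero]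
    exact h
  · simpa only [map_pow, map_sub, aeval_X] using hzero hA hpow

variable {N : ℕ} {s u s' u' : Matrix (Fin N) (Fin N) ℂ}

theorem isNilpotent_toLin'_mul_sub_one (hu : IsUnipotentMatrix u) (hc : Commute s u) :
    IsNilpotent (Matrix.toLin' (s * (u - 1))) :=
  (Matrix.isNilpotent_toLin'_iff _).mpr
    ((hc.sub_right (Commute.one_right _)).isNilpotent_mul_left hu)

theorem commute_toLin' {n R : Type*} [Fintype n] [DecidableEq n] [CommRing R] {A B : Matrix n n R}
    (h : Commute A B) : Commute (Matrix.toLin' A) (Matrix.toLin' B) :=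
  h.map (Matrix.toLinAlgEquiv' (R := R) (n := n))

theorem jordanChevalley_unique (hs : Module.End.IsSemisimple (Matrix.toLin' s))
    (hs' : Module.End.IsSemisimple (Matrix.toLin' s')) (hu : IsUnipotentMatrix u)
    (hu' : IsUnipotentMatrix u') (hc : Commute s u) (hc' : Commute s' u') (hunit : IsUnit s)
    (h : s * u = s' * u') : s = s' ∧ u = u' := by
  have hsum : Matrix.toLin' (s * (u - 1)) + Matrix.toLin' s =
      Matrix.toLin' (s' * (u' - 1)) + Matrix.toLin' s' := by
    simp only [← map_add, mul_sub, mul_one, sub_add_cancel, h]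
  have hcomm {s u : Matrix (Fin N) (Fin N) ℂ} (hc : Commute s u) :
      Commute (Matrix.toLin' (s * (u - 1))) (Matrix.toLin' s) :=
    commute_toLin' ((Commute.refl s).mul_left (hc.sub_right (Commute.one_right _)).symm)
  have hss' : s = s' := Matrix.toLin'.injective (Module.End.isNilpotent_isSemisimple_unique
    (isNilpotent_toLin'_mul_sub_one hu hc) hs (isNilpotent_toLin'_mul_sub_one hu' hc') hs'
    (hcomm hc) (hcomm hc') hsum).2
  exact ⟨hss', hunit.mul_left_cancel (by rw [h, hss'])⟩

theorem exists_jordanChevalley {χ : ℂ[X]} (hχ : χ ≠ 0) :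
    ∃ q : ℂ[X], ∀ A : Matrix (Fin N) (Fin N) ℂ, IsUnit A → aeval A χ = 0 →
      ∃ u, Module.End.IsSemisimple (Matrix.toLin' (aeval A q)) ∧ IsUnit (aeval A q) ∧
        IsUnipotentMatrix u ∧ Commute (aeval A q) u ∧ A = aeval A q * u := by
  obtain ⟨q, hq⟩ := exists_aeval_isSemisimple_and_isNilpotent_sub (n := Fin N) hχ
  refine ⟨q, fun A hA hAχ => ?_⟩
  obtain ⟨hs, hn⟩ := hq A hAχ
  have hc : Commute A (aeval A q) := commute_aeval_right (Commute.refl A) q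
  have hunit : IsUnit (aeval A q) := by
    simpa only [neg_sub, sub_add_cancel] using hn.neg.isUnit_add_right_of_commute hA
      ((Commute.refl A).sub_right hc).neg_right.symm
  obtain ⟨s, hs'⟩ := hunit
  rw [← hs'] at hs hn hc ⊢
  have hus : (s⁻¹.val * A) - 1 = s⁻¹.val * (A - s.val) := by rw [mul_sub, s.inv_mul]
  refine ⟨s⁻¹.val * A, hs, s.isUnit, ?_, ?_, (s.mul_inv_cancel_left A).symm⟩
  · rw [IsUnipotentMatrix, hus]
    exact (hc.symm.units_inv_left.sub_right
      (Commute.refl s.val).units_inv_left).isNilpotent_mul_left hn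
  · exact (Commute.refl s.val).units_inv_right.mul_right hc.symm

end JordanChevalley

section ExponentialPolynomials

variable {K : Type*} [Field K]

/-- The exponential monomials `(n, X) ↦ μ ^ n * q(X)`, with `q` a polynomial. -/
def expMonomial (μ : K) : K[X] →ₗ[K] ℕ → K[X] :=
  LinearMap.pi fun n => μ ^ n • LinearMap.id

/-- The specialization `X = n` of sequences `F n` of polynomials in `X`. -/
def diagEval : (ℕ → K[X]) →ₗ[K] ℕ → K :=
  LinearMap.pi fun n => leval (n : K) ∘ₗ LinearMap.proj n

variable (K) in
/-- The algebra of exponential polynomials: it is generated by the sequences `n ↦ μ ^ n * q(X)`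
with `μ ≠ 0`. -/
def expPolyAlgebra : Subalgebra K (ℕ → K[X]) :=
  Algebra.adjoin K {F | ∃ μ : K, μ ≠ 0 ∧ ∃ q, F = expMonomial μ q}

theorem expMonomial_apply (μ : K) (q : K[X]) (n : ℕ) : expMonomial μ q n = μ ^ n • q := rfl

theorem diagEval_apply (F : ℕ → K[X]) (n : ℕ) : diagEval F n = (F n).eval (n : K) := rfl

theorem expMonomial_mem_expPolyAlgebra {μ : K} (hμ : μ ≠ 0) (q : K[X]) :
    expMonomial μ q ∈ expPolyAlgebra K :=
  Algebra.subset_adjoin ⟨μ, hμ, q, rfl⟩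

theorem const_mem_expPolyAlgebra (q : K[X]) : (fun _ => q) ∈ expPolyAlgebra K := by
  have h : expMonomial 1 q = fun _ => q := by
    ext1 n; rw [expMonomial_apply, one_pow, one_smul]
  exact h ▸ expMonomial_mem_expPolyAlgebra one_ne_zero q

theorem expPolyAlgebra_le_iSup :
    Subalgebra.toSubmodule (expPolyAlgebra K) ≤
      ⨆ μ : {μ : K // μ ≠ 0}, LinearMap.range (expMonomial μ.1) := by
  rw [expPolyAlgebra, Algebra.adjoin_eq_span, Submodule.span_le]
  intro F hF
  suffices ∃ μ : K, μ ≠ 0 ∧ ∃ q, F = expMonomial μ q by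
    obtain ⟨μ, hμ, q, rfl⟩ := this
    exact Submodule.mem_iSup_of_mem ⟨μ, hμ⟩ ⟨q, rfl⟩
  induction hF using Submonoid.closure_induction with
  | mem _ h => exact h
  | one => exact ⟨1, one_ne_zero, 1, by ext1 n; simp [expMonomial_apply]⟩
  | mul _ _ _ _ h h' =>
    obtain ⟨μ, hμ, q, rfl⟩ := h
    obtain ⟨μ', hμ', q', rfl⟩ := h'
    refine ⟨μ * μ', mul_ne_zero hμ hμ', q * q', ?_⟩
    ext1 n
    simp only [expMonomial_apply, Pi.mul_apply, mul_pow, smul_mul_smul_comm]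

theorem diagEval_expMonomial_mem_maxGenEigenspace (μ : K) (q : K[X]) :
    diagEval (expMonomial μ q) ∈
      Module.End.maxGenEigenspace (LinearMap.funLeft K K Nat.succ) μ := by
  have hiter (k : ℕ) : ((LinearMap.funLeft K K Nat.succ - μ • (1 : Module.End K (ℕ → K))) ^ k)
      (diagEval (expMonomial μ q)) = fun n => μ ^ (n + k) * ((fwdDiff (1 : K))^[k] q.eval) n := by
    induction k with
    | zero => ext n; simp [diagEval_apply, expMonomial_apply]
    | succ k ih =>
      rw [pow_succ', Module.End.mul_apply, ih]
      ext n
      rw [Function.iterate_succ_apply']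
      simp only [LinearMap.sub_apply, LinearMap.smul_apply, Module.End.one_apply, Pi.sub_apply,
        LinearMap.funLeft_apply, Nat.succ_eq_add_one, Nat.cast_add, Nat.cast_one, Pi.smul_apply,
        smul_eq_mul, fwdDiff]
      ring
  rw [Module.End.mem_maxGenEigenspace]
  refine ⟨q.natDegree + 1, ?_⟩
  rw [hiter, Polynomial.fwdDiff_iter_degree_add_one_eq_zero]
  simp only [Pi.zero_apply, mul_zero]
  rfl

theorem expMonomial_eq_zero_of_diagEval_eq_zero [CharZero K] {μ : K} (hμ : μ ≠ 0) {q : K[X]}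
    (h : diagEval (expMonomial μ q) = 0) : expMonomial μ q = 0 := by
  suffices q = 0 by rw [this, map_zero]
  refine q.eq_zero_of_infinite_isRoot
    ((Set.infinite_range_of_injective (Nat.cast_injective (R := K))).mono ?_)
  rintro _ ⟨n, rfl⟩
  have hn : μ ^ n * q.eval (n : K) = 0 := by
    simpa only [diagEval_apply, expMonomial_apply, eval_smul, smul_eq_mul,
      Pi.zero_apply] using congrFun h n
  exact (mul_eq_zero.mp hn).resolve_left (pow_ne_zero n hμ)

/-- The terms `n ↦ μ ^ n * q(n)` lie in independent generalized eigenspaces of the shift. -/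
theorem eq_zero_of_diagEval_eq_zero [CharZero K] {F : ℕ → K[X]} (hF : F ∈ expPolyAlgebra K)
    (h : diagEval F = 0) : F = 0 := by
  obtain ⟨f, hf, rfl⟩ := (Submodule.mem_iSup_iff_exists_finsupp _ _).mp (expPolyAlgebra_le_iSup hF)
  choose q hq using hf
  have hindep := (Module.End.independent_maxGenEigenspace
    (LinearMap.funLeft K K Nat.succ)).comp (Subtype.val_injective (p := fun μ : K => μ ≠ 0))
  rw [iSupIndep_iff_finsetSum_eq_zero_imp_eq_zero] at hindep
  have hzero := hindep f.support (fun μ => diagEval (f μ))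
    (fun μ _ => hq μ ▸ diagEval_expMonomial_mem_maxGenEigenspace μ.1 (q μ))
    (by rw [← map_sum]; exact h)
  refine Finset.sum_eq_zero fun μ hμ => ?_
  rw [← hq μ, expMonomial_eq_zero_of_diagEval_eq_zero μ.2 (hq μ ▸ hzero μ hμ)]

end ExponentialPolynomials

section ZariskiClosure

theorem toLin'_pow_apply_of_mem_eigenspace {n R : Type*} [Fintype n] [DecidableEq n] [CommRing R]
    {A : Matrix n n R} {μ : R} {v : n → R}
    (hv : v ∈ Module.End.eigenspace (Matrix.toLin' A) μ) (m : ℕ) :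
    Matrix.toLin' (A ^ m) v = μ ^ m • v := by
  rw [Module.End.mem_eigenspace_iff] at hv
  induction m with
  | zero => simp
  | succ m ih =>
    rw [pow_succ, Matrix.toLin'_mul, LinearMap.comp_apply, hv, map_smul, ih, smul_smul, pow_succ']

theorem eq_zero_of_mem_eigenspace_zero {n R : Type*} [Fintype n] [DecidableEq n] [CommRing R]
    {A : Matrix n n R} (hA : IsUnit A) {v : n → R}
    (hv : v ∈ Module.End.eigenspace (Matrix.toLin' A) 0) : v = 0 := by
  rw [Module.End.mem_eigenspace_iff, zero_smul, Matrix.toLin'_apply] at hv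
  exact Matrix.mulVec_injective_of_isUnit hA (hv.trans (Matrix.mulVec_zero A).symm)

theorem pow_apply_mem_expPolyAlgebra {K n : Type*} [Field K] [IsAlgClosed K] [Fintype n]
    [DecidableEq n] {s : Matrix n n K} (hs : Module.End.IsSemisimple (Matrix.toLin' s))
    (hunit : IsUnit s) (i j : n) : (fun m => C ((s ^ m) i j)) ∈ expPolyAlgebra K := by
  suffices ∀ v : n → K, (fun m => C (Matrix.toLin' (s ^ m) v i)) ∈ expPolyAlgebra K by
    simpa only [Matrix.toLin'_apply, Matrix.mulVec_single_one, Matrix.col_apply] using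
      this (Pi.single j 1)
  intro v
  have hv : v ∈ ⨆ μ, Module.End.maxGenEigenspace (Matrix.toLin' s) μ := by
    rw [Module.End.iSup_maxGenEigenspace_eq_top]; trivial
  induction hv using Submodule.iSup_induction' with
  | mem μ v hv =>
    rw [hs.isFinitelySemisimple.maxGenEigenspace_eq_eigenspace] at hv
    have hpow : (fun m => C (Matrix.toLin' (s ^ m) v i)) = expMonomial μ (C (v i)) := by
      ext1 m
      rw [toLin'_pow_apply_of_mem_eigenspace hv, expMonomial_apply, smul_C, Pi.smul_apply]
    rw [hpow]
    rcases eq_or_ne μ 0 with rfl | hμ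
    · rw [eq_zero_of_mem_eigenspace_zero hunit hv, Pi.zero_apply, C_0, map_zero]
      exact zero_mem _
    · exact expMonomial_mem_expPolyAlgebra hμ _
  | zero => simpa only [map_zero, Pi.zero_apply] using! zero_mem (expPolyAlgebra K)
  | add v v' _ _ h h' => simpa only [map_add, Pi.add_apply] using! add_mem h h'

variable {N : ℕ} {s u : Matrix (Fin N) (Fin N) ℂ}

/-- The one-parameter group `exp (X a)` of a nilpotent matrix `a`, as a matrix of polynomials. -/
def expPolynomialMatrix (a : Matrix (Fin N) (Fin N) ℂ) : Matrix (Fin N) (Fin N) ℂ[X] :=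
  ∑ m ∈ Finset.range N, (C (m.factorial : ℂ)⁻¹ * X ^ m) • (a ^ m).map C

open scoped Matrix.Norms.Operator in
theorem eval_expPolynomialMatrix {a : Matrix (Fin N) (Fin N) ℂ} (ha : IsNilpotent a) (c : ℂ) :
    (expPolynomialMatrix a).map (eval c) = NormedSpace.exp (c • a) := by
  have hpow : (c • a) ^ N = 0 := by
    simpa only [Fintype.card_fin] using pow_eq_zero_of_isNilpotent (ha.smul c)
  rw [exp_eq_sum_range_of_pow_eq_zero (K := ℂ) hpow]
  ext i j
  simp only [expPolynomialMatrix, Matrix.map_apply, Matrix.sum_apply, Matrix.smul_apply,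
    smul_eq_mul, eval_finsetSum, eval_mul, eval_C, eval_pow, eval_X, smul_pow, mul_assoc]

theorem eval_mvPolynomial_aeval {σ ι R : Type*} [CommRing R] (x : σ → ι → R[X])
    (f : MvPolynomial σ R) (n : ι) (c : R) :
    (MvPolynomial.aeval x f n).eval c = MvPolynomial.eval (fun p => (x p n).eval c) f := by
  have h := MvPolynomial.map_aeval x ((evalRingHom c).comp (Pi.evalRingHom (fun _ => R[X]) n)) f
  have hC : ((evalRingHom c).comp (Pi.evalRingHom (fun _ : ι => R[X]) n)).comp
      (algebraMap R (ι → R[X])) = RingHom.id R := by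
    ext r; simp
  rw [hC] at h
  exact h

/-- A polynomial equation in the entries of `s ^ n * u ^ b` that holds for all `b = n ∈ ℕ` holds
for independent `n` and `b`, as exponential polynomials are determined by their diagonal values. -/
theorem IsZariskiClosed.exists_pow_mul_exp_mem {Z : Set (GL (Fin N) ℂ)} (hZ : IsZariskiClosed Z)
    (hs : Module.End.IsSemisimple (Matrix.toLin' s)) (hunit : IsUnit s)
    (hu : IsUnipotentMatrix u) (hc : Commute s u)
    (h : ∀ n : ℕ, ∃ g ∈ Z, (g : Matrix (Fin N) (Fin N) ℂ) = (s * u) ^ n) (a : ℕ) (b : ℂ) :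
    ∃ g ∈ Z, (g : Matrix (Fin N) (Fin N) ℂ) = s ^ a * NormedSpace.exp (b • unipotentLog u) := by
  obtain ⟨S, rfl⟩ := hZ
  obtain ⟨g, hg⟩ : IsUnit (s ^ a * NormedSpace.exp (b • unipotentLog u)) :=
    (hunit.pow a).mul (Matrix.isUnit_exp _)
  refine ⟨g, fun f hf => ?_, hg⟩
  let x (p : Fin N × Fin N) (n : ℕ) : ℂ[X] :=
    ((s ^ n).map C * expPolynomialMatrix (unipotentLog u)) p.1 p.2
  have hmem : MvPolynomial.aeval x f ∈ expPolyAlgebra ℂ := by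
    have hx : Set.range x ⊆ expPolyAlgebra ℂ := by
      rintro _ ⟨p, rfl⟩
      have hsum : x p = ∑ l, (fun n => C ((s ^ n) p.1 l)) *
          fun _ => expPolynomialMatrix (unipotentLog u) l p.2 := by
        ext1 n
        simp only [x, Matrix.mul_apply, Matrix.map_apply, Finset.sum_apply, Pi.mul_apply]
      rw [hsum]
      exact sum_mem fun l _ => mul_mem (pow_apply_mem_expPolyAlgebra hs hunit _ _)
        (const_mem_expPolyAlgebra _)
    refine Algebra.adjoin_le hx ?_
    rw [Algebra.adjoin_range_eq_range_aeval]
    exact ⟨f, rfl⟩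
  have heval (n : ℕ) (c : ℂ) : (MvPolynomial.aeval x f n).eval c = MvPolynomial.eval
      (fun p => (s ^ n * NormedSpace.exp (c • unipotentLog u)) p.1 p.2) f := by
    rw [eval_mvPolynomial_aeval, ← eval_expPolynomialMatrix (isNilpotent_unipotentLog hu)]
    simp only [x, Matrix.mul_apply, Matrix.map_apply, eval_finsetSum, eval_mul, eval_C]
  have hdiag : diagEval (MvPolynomial.aeval x f) = 0 := by
    ext n
    obtain ⟨g', hg', hgn⟩ := h n
    rw [diagEval_apply, heval, Nat.cast_smul_eq_nsmul, Matrix.exp_nsmul, exp_unipotentLog hu,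
      ← hc.mul_pow, ← hgn]
    exact hg' f hf
  rw [hg, ← heval, eq_zero_of_diagEval_eq_zero hmem hdiag, Pi.zero_apply, eval_zero]

end ZariskiClosure

namespace ReductiveGroup

variable {F H : Type*} [NormedAddCommGroup F] [NormedSpace ℂ F]
  [TopologicalSpace H] [ChartedSpace F H] [Group H] (R : ReductiveGroup F H)

theorem log_eq_unipotentLog (u : H) : R.log u = unipotentLog (R.mat u) :=
  (aeval_logTaylor _ _).symm

@[simp] theorem mat_mul (a b : H) : R.mat (a * b) = R.mat a * R.mat b := by
  simp only [mat, map_mul, Units.val_mul]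

@[simp] theorem mat_one : R.mat (1 : H) = 1 := by
  simp only [mat, map_one, Units.val_one]

@[simp] theorem mat_pow (a : H) (n : ℕ) : R.mat (a ^ n) = R.mat a ^ n := by
  simp only [mat, map_pow, Units.val_pow_eq_pow_val]

@[simp] theorem mat_inv (a : H) : R.mat a⁻¹ = (R.mat a)⁻¹ := by
  simp only [mat, map_inv, Matrix.coe_units_inv]

theorem isUnit_mat (a : H) : IsUnit (R.mat a) := (R.ρ a).isUnit

theorem mat_injective : Function.Injective R.mat := fun _ _ h =>
  R.embedding.isEmbedding.injective h

variable {R} in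
theorem commute_mat_iff {a b : H} : Commute (R.mat a) (R.mat b) ↔ Commute a b := by
  rw [Commute, Commute, SemiconjBy, SemiconjBy, ← mat_mul, ← mat_mul, R.mat_injective.eq_iff]

theorem isSemisimple_one : R.IsSemisimple 1 := by
  rw [IsSemisimple, mat_one, Matrix.toLin'_one]
  exact Module.End.isSemisimple_id

theorem exists_mat_eq_pow_mul_exp (m : H) {s u : Matrix (Fin R.N) (Fin R.N) ℂ}
    (hs : Module.End.IsSemisimple (Matrix.toLin' s)) (hunit : IsUnit s)
    (hu : IsUnipotentMatrix u) (hc : Commute s u) (h : R.mat m = s * u) (a : ℕ) (b : ℂ) :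
    ∃ c : H, R.mat c = s ^ a * NormedSpace.exp (b • unipotentLog u) := by
  obtain ⟨_, ⟨c, rfl⟩, hc⟩ := R.zariskiClosed.exists_pow_mul_exp_mem hs hunit hu hc
    (fun n => ⟨R.ρ (m ^ n), ⟨_, rfl⟩, by rw [← h, ← mat_pow, mat]⟩) a b
  exact ⟨c, hc⟩

theorem exists_mat_eq_exp_smul_log {u : H} (hu : R.IsUnipotent u) (b : ℂ) :
    ∃ c : H, R.mat c = NormedSpace.exp (b • R.log u) := by
  simpa only [pow_zero, one_mul, log_eq_unipotentLog] using
    R.exists_mat_eq_pow_mul_exp u (R.mat_one ▸ R.isSemisimple_one) isUnit_one hu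
      (Commute.one_left _) (one_mul _).symm 0 b

theorem commute_log {u v : H} (h : Commute u v) : Commute (R.log u) (R.log v) := by
  simpa only [log_eq_unipotentLog] using commute_unipotentLog (commute_mat_iff.mpr h)

theorem log_conj (u a : H) : R.log (a⁻¹ * u * a) = R.mat a⁻¹ * R.log u * R.mat a := by
  rw [log_eq_unipotentLog, log_eq_unipotentLog, mat_mul, mat_mul]
  simpa only [← map_inv, inv_inv, mat] using unipotentLog_units_conj (R.ρ a)⁻¹ (R.mat u)

variable {R} in
theorem IsUnipotent.log_inv {u : H} (hu : R.IsUnipotent u) : R.log u⁻¹ = -R.log u := by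
  rw [log_eq_unipotentLog, log_eq_unipotentLog, mat_inv, unipotentLog_inv hu]

variable {R} in
theorem IsUnipotent.isNilpotent_log {u : H} (hu : R.IsUnipotent u) : IsNilpotent (R.log u) := by
  rw [log_eq_unipotentLog]
  exact isNilpotent_unipotentLog hu

variable {R} in
theorem IsUnipotent.exp_log {u : H} (hu : R.IsUnipotent u) :
    NormedSpace.exp (R.log u) = R.mat u := by
  rw [log_eq_unipotentLog, exp_unipotentLog hu]

theorem commute_sum_smul_log {ι : Type*} (t t' : Finset ι) (z z' : ι → ℂ) {u : ι → H}
    (hc : ∀ i j, Commute (u i) (u j)) :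
    Commute (∑ j ∈ t, z j • R.log (u j)) (∑ j ∈ t', z' j • R.log (u j)) :=
  Commute.sum_left _ _ _ fun i _ => Commute.sum_right _ _ _ fun j _ =>
    ((R.commute_log (hc i j)).smul_left _).smul_right _

theorem exists_mat_eq_exp_sum {ι : Type*} (t : Finset ι) (z : ι → ℂ) {u : ι → H}
    (hu : ∀ j, R.IsUnipotent (u j)) (hc : ∀ i j, Commute (u i) (u j)) :
    ∃ c : H, R.mat c = NormedSpace.exp (∑ j ∈ t, z j • R.log (u j)) := by
  classical
  induction t using Finset.induction_on with
  | empty => exact ⟨1, by rw [mat_one, Finset.sum_empty, NormedSpace.exp_zero]⟩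
  | insert a t ha ih =>
    obtain ⟨c, hc'⟩ := ih
    obtain ⟨d, hd⟩ := R.exists_mat_eq_exp_smul_log (hu a) (z a)
    have hcomm := R.commute_sum_smul_log {a} t z z hc
    rw [Finset.sum_singleton] at hcomm
    exact ⟨d * c, by
      rw [Finset.sum_insert ha, Matrix.exp_add_of_commute _ _ hcomm, mat_mul, hd, hc']⟩

theorem exists_isExpLog {k : ℕ} (z : Fin k → ℂ) {u : Fin k → H}
    (hu : ∀ j, R.IsUnipotent (u j)) (hc : ∀ i j, Commute (u i) (u j)) :
    ∃ c : H, R.IsExpLog z u c := by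
  obtain ⟨c, h⟩ := R.exists_mat_eq_exp_sum Finset.univ
    (fun j => (-1 / (2 * Real.pi * Complex.I) : ℂ) * z j) hu hc
  exact ⟨c, by simpa only [IsExpLog, Finset.smul_sum, smul_smul] using h⟩

variable {R}

section IsExpLog

variable {k : ℕ} {z z' : Fin k → ℂ} {u : Fin k → H} {c c' : H}

theorem IsExpLog.unique (h : R.IsExpLog z u c) (h' : R.IsExpLog z u c') : c = c' :=
  R.mat_injective (h.trans h'.symm)

theorem isExpLog_zero (u : Fin k → H) : R.IsExpLog 0 u 1 := by
  simp only [IsExpLog, mat_one, Pi.zero_apply, zero_smul, Finset.sum_const_zero, smul_zero,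
    NormedSpace.exp_zero]

theorem IsExpLog.add (hc : ∀ i j, Commute (u i) (u j)) (h : R.IsExpLog z u c)
    (h' : R.IsExpLog z' u c') : R.IsExpLog (z + z') u (c * c') := by
  have hcomm := ((R.commute_sum_smul_log Finset.univ Finset.univ z z' hc).smul_left
    (-1 / (2 * Real.pi * Complex.I) : ℂ)).smul_right (-1 / (2 * Real.pi * Complex.I) : ℂ)
  rw [IsExpLog, mat_mul, h, h', ← Matrix.exp_add_of_commute _ _ hcomm]
  simp only [← smul_add, ← Finset.sum_add_distrib, ← add_smul, Pi.add_apply]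

theorem IsExpLog.neg (h : R.IsExpLog z u c) : R.IsExpLog (-z) u c⁻¹ := by
  rw [IsExpLog] at h ⊢
  simp only [mat_inv, h, Pi.neg_apply, neg_smul, Finset.sum_neg_distrib, smul_neg,
    Matrix.exp_neg]

theorem IsExpLog.conj (h : R.IsExpLog z u c) (a : H) :
    R.IsExpLog z (fun j => a⁻¹ * u j * a) (a⁻¹ * c * a) := by
  have hexp := Matrix.exp_units_conj' (R.ρ a)
    ((-1 / (2 * Real.pi * Complex.I) : ℂ) • ∑ j, z j • R.log (u j))
  rw [← map_inv] at hexp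
  rw [IsExpLog, mat_mul, mat_mul, h, mat, mat, ← hexp]
  simp only [log_conj, mat, Finset.mul_sum, Finset.sum_mul, mul_smul_comm, smul_mul_assoc]

theorem IsExpLog.inv (hu : ∀ j, R.IsUnipotent (u j)) (h : R.IsExpLog z u c) :
    R.IsExpLog z (fun j => (u j)⁻¹) c⁻¹ := by
  rw [IsExpLog] at h ⊢
  simp only [mat_inv, h, (hu _).log_inv, smul_neg, Finset.sum_neg_distrib, Matrix.exp_neg]

open scoped Matrix.Norms.Operator in
theorem IsExpLog.commute {a : H} (h : R.IsExpLog z u c) (ha : ∀ j, Commute a (u j)) :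
    Commute a c := by
  rw [← commute_mat_iff (R := R), h]
  refine ((Commute.sum_right _ _ _ fun j _ => ?_).smul_right _).exp_right
  rw [log_eq_unipotentLog]
  exact (commute_unipotentLog_right (commute_mat_iff.mpr (ha j))).smul_right _

end IsExpLog

theorem IsUnipotent.inv {u : H} (hu : R.IsUnipotent u) : R.IsUnipotent u⁻¹ := by
  rw [IsUnipotent, mat_inv]
  exact IsUnipotentMatrix.inv hu

theorem IsUnipotent.mul {u v : H} (hu : R.IsUnipotent u) (hv : R.IsUnipotent v)
    (h : Commute u v) : R.IsUnipotent (u * v) := by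
  rw [IsUnipotent, mat_mul]
  exact IsUnipotentMatrix.mul hu hv (commute_mat_iff.mpr h)

theorem IsSemisimple.mul {s t : H} (hs : R.IsSemisimple s) (ht : R.IsSemisimple t)
    (h : Commute s t) : R.IsSemisimple (s * t) := by
  rw [IsSemisimple, mat_mul, Matrix.toLin'_mul]
  exact Module.End.IsSemisimple.mul_of_commute (commute_toLin' (commute_mat_iff.mpr h)) hs ht

theorem IsJordanChevalley.unique {m s u s' u' : H} (h : R.IsJordanChevalley m s u)
    (h' : R.IsJordanChevalley m s' u') : s = s' ∧ u = u' := by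
  obtain ⟨hs, hu, rfl, hc⟩ := h
  obtain ⟨hs', hu', hm, hc'⟩ := h'
  have hmat := jordanChevalley_unique hs hs' hu hu' (commute_mat_iff.mpr hc)
    (commute_mat_iff.mpr hc') (R.isUnit_mat s) (by rw [← mat_mul, ← mat_mul, hm])
  exact ⟨R.mat_injective hmat.1, R.mat_injective hmat.2⟩

variable (R)

theorem exists_isJordanChevalley_mat_eq_aeval {χ : ℂ[X]} (hχ : χ ≠ 0) :
    ∃ q : ℂ[X], ∀ m : H, (R.mat m).charpoly = χ →
      ∃ s u : H, R.IsJordanChevalley m s u ∧ R.mat s = aeval (R.mat m) q := by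
  obtain ⟨q, hq⟩ := exists_jordanChevalley (N := R.N) hχ
  refine ⟨q, fun m hm => ?_⟩
  obtain ⟨v, hs, hunit, hv, hc, hmv⟩ := hq (R.mat m) (R.isUnit_mat m)
    (hm ▸ Matrix.aeval_self_charpoly _)
  obtain ⟨s, hs'⟩ := R.exists_mat_eq_pow_mul_exp m hs hunit hv hc hmv 1 0
  obtain ⟨u, hu'⟩ := R.exists_mat_eq_pow_mul_exp m hs hunit hv hc hmv 0 1
  rw [pow_one, zero_smul, NormedSpace.exp_zero, mul_one] at hs'
  rw [pow_zero, one_smul, one_mul, exp_unipotentLog hv] at hu'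
  refine ⟨s, u, ⟨?_, ?_, R.mat_injective ?_, R.mat_injective ?_⟩, hs'⟩
  · rwa [IsSemisimple, hs']
  · rwa [IsUnipotent, hu']
  · rwa [mat_mul, hs', hu']
  · rw [mat_mul, mat_mul, hs', hu', hc.eq]

theorem exists_isJordanChevalley (m : H) : ∃ s u : H, R.IsJordanChevalley m s u := by
  obtain ⟨q, hq⟩ := R.exists_isJordanChevalley_mat_eq_aeval (R.mat m).charpoly_monic.ne_zero
  obtain ⟨s, u, h, -⟩ := hq m rfl
  exact ⟨s, u, h⟩

variable {R}

theorem IsJordanChevalley.commute {m s u a : H} (h : R.IsJordanChevalley m s u)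
    (ha : Commute a m) : Commute a s ∧ Commute a u := by
  obtain ⟨q, hq⟩ := R.exists_isJordanChevalley_mat_eq_aeval (R.mat m).charpoly_monic.ne_zero
  obtain ⟨s', u', h', hs'⟩ := hq m rfl
  obtain ⟨rfl, rfl⟩ := h.unique h'
  have has : Commute a s := commute_mat_iff.mp <| by
    rw [hs']
    exact commute_aeval_right (commute_mat_iff.mpr ha) q
  have hu : u = s⁻¹ * m := by rw [h.2.2.1, inv_mul_cancel_left]
  exact ⟨has, hu ▸ has.inv_right.mul_right ha⟩

end ReductiveGroup

/-! ### Exponential sections on the lattice -/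

section Lattice

variable {k : ℕ}

theorem lattice_apply (n : Fin k → ℤ) (j : Fin k) :
    lattice n j = 2 * Real.pi * Complex.I * n j := rfl

theorem lattice_add (n n' : Fin k → ℤ) : lattice (n + n') = lattice n + lattice n' :=
  funext fun j => by simp only [lattice_apply, Pi.add_apply, Int.cast_add, mul_add]

theorem lattice_zero : lattice (0 : Fin k → ℤ) = 0 :=
  funext fun j => by simp only [lattice_apply, Pi.zero_apply, Int.cast_zero, mul_zero]

theorem lattice_neg (n : Fin k → ℤ) : lattice (-n) = -lattice n :=
  funext fun j => by simp only [lattice_apply, Pi.neg_apply, Int.cast_neg, mul_neg]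

theorem expTorus_lattice (n : Fin k → ℤ) : expTorus (lattice n) = 1 :=
  funext fun j => Units.ext <| by
    rw [expTorus, Units.val_mk0, lattice_apply, mul_comm]
    exact Complex.exp_int_mul_two_pi_mul_I (n j)

end Lattice

namespace ReductiveGroup

variable {F H : Type*} [NormedAddCommGroup F] [NormedSpace ℂ F]
  [TopologicalSpace H] [ChartedSpace F H] [Group H] {R : ReductiveGroup F H} {k : ℕ}

theorem isExpLog_lattice_single {u : Fin k → H} (j : Fin k) (hu : R.IsUnipotent (u j)) :
    R.IsExpLog (lattice (Pi.single j 1)) u (u j)⁻¹ := by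
  have hsum : (∑ i, lattice (Pi.single j 1) i • R.log (u i)) =
      (2 * Real.pi * Complex.I : ℂ) • R.log (u j) := by
    rw [Finset.sum_eq_single_of_mem j (Finset.mem_univ j)]
    · rw [lattice_apply, Pi.single_eq_same, Int.cast_one, mul_one]
    · intro i _ hij
      rw [lattice_apply, Pi.single_eq_of_ne hij, Int.cast_zero, mul_zero, zero_smul]
  rw [IsExpLog, hsum, smul_smul, div_mul_cancel₀ _ Complex.two_pi_I_ne_zero, neg_one_smul,
    Matrix.exp_neg, hu.exp_log, mat_inv]

theorem isExpLog_lattice (u : Multiplicative (Fin k → ℤ) →* H) (hu : ∀ n, R.IsUnipotent (u n))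
    (n : Fin k → ℤ) :
    R.IsExpLog (lattice n) (fun j => u (.ofAdd (Pi.single j 1))) (u (.ofAdd n))⁻¹ := by
  have hcomm : ∀ n n', Commute (u n) (u n') := fun n n' => (Commute.all n n').map u
  let S : AddSubgroup (Fin k → ℤ) :=
    { carrier := {n | R.IsExpLog (lattice n) (fun j => u (.ofAdd (Pi.single j 1)))
        (u (.ofAdd n))⁻¹}
      zero_mem' := by
        simpa only [Set.mem_ofPred_eq, lattice_zero, ofAdd_zero, map_one, inv_one] using
          isExpLog_zero _
      add_mem' := fun {a b} ha hb => by
        simpa only [Set.mem_ofPred_eq, lattice_add, ofAdd_add, map_mul, mul_inv_rev,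
          (hcomm _ _).inv_inv.eq] using IsExpLog.add (fun _ _ => hcomm _ _) ha hb
      neg_mem' := fun {a} ha => by
        simpa only [Set.mem_ofPred_eq, lattice_neg, ofAdd_neg, map_inv] using IsExpLog.neg ha }
  have hsingle : ∀ j, Pi.single j 1 ∈ S := fun j =>
    isExpLog_lattice_single (u := fun j => u (.ofAdd (Pi.single j 1))) j (hu _)
  have hn : n = ∑ j, n j • Pi.single j (1 : ℤ) := by
    simp only [← Pi.single_smul, smul_eq_mul, mul_one, Finset.univ_sum_single]
  rw [hn]
  exact S.sum_mem fun j _ => S.zsmul_mem (hsingle j) _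

end ReductiveGroup

/-! ### Jordan components -/

namespace ReductiveGroup

variable {F H : Type*} [NormedAddCommGroup F] [NormedSpace ℂ F]
  [TopologicalSpace H] [ChartedSpace F H] [Group H] (R : ReductiveGroup F H)

/-- The semisimple component of the multiplicative Jordan–Chevalley decomposition. -/
def semisimplePart (m : H) : H := (R.exists_isJordanChevalley m).choose

/-- The unipotent component of the multiplicative Jordan–Chevalley decomposition. -/
def unipotentPart (m : H) : H := (R.exists_isJordanChevalley m).choose_spec.choose

theorem isJordanChevalley_parts (m : H) :
    R.IsJordanChevalley m (R.semisimplePart m) (R.unipotentPart m) :=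
  (R.exists_isJordanChevalley m).choose_spec.choose_spec

theorem exists_mat_semisimplePart_eq_aeval {χ : ℂ[X]} (hχ : χ ≠ 0) :
    ∃ q : ℂ[X], ∀ m : H, (R.mat m).charpoly = χ →
      R.mat (R.semisimplePart m) = aeval (R.mat m) q := by
  obtain ⟨q, hq⟩ := R.exists_isJordanChevalley_mat_eq_aeval hχ
  refine ⟨q, fun m hm => ?_⟩
  obtain ⟨s, u, h, hs⟩ := hq m hm
  rw [((R.isJordanChevalley_parts m).unique h).1, hs]

theorem charpoly_mat_conj (m a : H) : (R.mat (a⁻¹ * m * a)).charpoly = (R.mat m).charpoly := by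
  rw [mat_mul, Matrix.charpoly_mul_comm, ← mat_mul, ← mul_assoc, mul_inv_cancel, one_mul]

variable {R}

theorem IsJordanChevalley.unipotentPart_eq {m s u : H} (h : R.IsJordanChevalley m s u) :
    R.unipotentPart m = u :=
  ((R.isJordanChevalley_parts m).unique h).2

theorem IsJordanChevalley.mul {m s u m' s' u' : H} (h : R.IsJordanChevalley m s u)
    (h' : R.IsJordanChevalley m' s' u') (hc : Commute m m') :
    R.IsJordanChevalley (m * m') (s * s') (u * u') := by
  obtain ⟨hms', hmu'⟩ := h'.commute hc
  obtain ⟨hs's, hs'u⟩ := h.commute hms'.symm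
  obtain ⟨hu's, hu'u⟩ := h.commute hmu'.symm
  obtain ⟨hs, hu, rfl, hsu⟩ := h
  obtain ⟨hs', hu', rfl, hsu'⟩ := h'
  exact ⟨hs.mul hs' hs's.symm, hu.mul hu' hu'u.symm, hs'u.symm.mul_mul_mul_comm s u',
    ((Commute.mul_right hsu hu's.symm).mul_left (hs'u.mul_right hsu')).eq⟩

theorem IsSemisimple.conj {s : H} (hs : R.IsSemisimple s) (a : H) :
    R.IsSemisimple (a⁻¹ * s * a) := by
  have hinv : R.mat a * R.mat a⁻¹ = 1 := by rw [← mat_mul, mul_inv_cancel, mat_one]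
  have hinv' : R.mat a⁻¹ * R.mat a = 1 := by rw [← mat_mul, inv_mul_cancel, mat_one]
  refine (LinearEquiv.isSemisimple_iff _ _ (Matrix.toLin'OfInv hinv hinv') ?_).mp hs
  change Matrix.toLin' (R.mat a⁻¹) ∘ₗ Matrix.toLin' (R.mat s) =
    Matrix.toLin' (R.mat (a⁻¹ * s * a)) ∘ₗ Matrix.toLin' (R.mat a⁻¹)
  rw [← Matrix.toLin'_mul, ← Matrix.toLin'_mul, ← mat_mul, ← mat_mul, mul_inv_cancel_right]

theorem IsUnipotent.conj {u : H} (hu : R.IsUnipotent u) (a : H) :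
    R.IsUnipotent (a⁻¹ * u * a) := by
  have h : R.mat (a⁻¹ * u * a) - 1 =
      (R.ρ a)⁻¹.val * (R.mat u - 1) * (R.ρ a).val := by
    rw [mul_sub_one, sub_mul, Units.inv_mul, ← map_inv, mat_mul, mat_mul, mat, mat, mat]
  obtain ⟨n, hn⟩ := hu
  exact ⟨n, by rw [h, Units.conj_pow', hn, mul_zero, zero_mul]⟩

theorem IsJordanChevalley.conj {m s u : H} (h : R.IsJordanChevalley m s u) (a : H) :
    R.IsJordanChevalley (a⁻¹ * m * a) (a⁻¹ * s * a) (a⁻¹ * u * a) := by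
  refine ⟨h.1.conj a, h.2.1.conj a, ?_, ?_⟩
  · rw [h.2.2.1]
    group
  · have hconj : Commute (a⁻¹ * s * a) (a⁻¹ * u * a) := by
      simpa only [MulAut.conj_apply, inv_inv] using Commute.map h.2.2.2 (MulAut.conj a⁻¹)
    exact hconj

end ReductiveGroup

/-! ### Holomorphic matrix-valued maps -/

section HolomorphicMatrices

variable {EM HM M : Type*} [NormedAddCommGroup EM] [NormedSpace ℂ EM] [TopologicalSpace HM]
  {I : ModelWithCorners ℂ EM HM} [TopologicalSpace M] [ChartedSpace HM M] {n : Type*}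

variable (I) in
/-- Holomorphy at a point of a matrix-valued map, expressed through its entries: this avoids the
choice of a norm on matrices. -/
def HolomorphicMatrixAt (f : M → Matrix n n ℂ) (x : M) : Prop :=
  ∀ i j, ContMDiffAt I 𝓘(ℂ, ℂ) ω (fun y => f y i j) x

namespace HolomorphicMatrixAt

theorem const (A : Matrix n n ℂ) (x : M) : HolomorphicMatrixAt I (fun _ => A) x :=
  fun _ _ => contMDiffAt_const

variable {f g : M → Matrix n n ℂ} {x : M}

theorem sub (hf : HolomorphicMatrixAt I f x) (hg : HolomorphicMatrixAt I g x) :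
    HolomorphicMatrixAt I (fun y => f y - g y) x :=
  fun i j => (hf i j).sub (hg i j)

theorem smul {c : M → ℂ} (hc : ContMDiffAt I 𝓘(ℂ, ℂ) ω c x) (hf : HolomorphicMatrixAt I f x) :
    HolomorphicMatrixAt I (fun y => c y • f y) x :=
  fun i j => hc.mul (hf i j)

theorem sum {ι : Type*} {t : Finset ι} {f : ι → M → Matrix n n ℂ}
    (hf : ∀ l ∈ t, HolomorphicMatrixAt I (f l) x) :
    HolomorphicMatrixAt I (fun y => ∑ l ∈ t, f l y) x := by
  intro i j
  simp only [Matrix.sum_apply]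
  exact ContMDiffAt.sum fun l hl => hf l hl i j

variable [Fintype n]

theorem mul (hf : HolomorphicMatrixAt I f x) (hg : HolomorphicMatrixAt I g x) :
    HolomorphicMatrixAt I (fun y => f y * g y) x := by
  intro i j
  simp only [Matrix.mul_apply]
  exact ContMDiffAt.sum fun l _ => (hf i l).mul (hg l j)

variable [DecidableEq n]

theorem pow (hf : HolomorphicMatrixAt I f x) (m : ℕ) :
    HolomorphicMatrixAt I (fun y => f y ^ m) x := by
  induction m with
  | zero => simpa only [pow_zero] using const 1 x
  | succ m ih => simpa only [pow_succ] using ih.mul hf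

theorem aeval (hf : HolomorphicMatrixAt I f x) (q : ℂ[X]) :
    HolomorphicMatrixAt I (fun y => Polynomial.aeval (f y) q) x := by
  simp only [aeval_eq_sum_range]
  exact sum fun m _ => smul contMDiffAt_const (hf.pow m)

theorem unipotentLog {N : ℕ} {f : M → Matrix (Fin N) (Fin N) ℂ}
    (hf : HolomorphicMatrixAt I f x) :
    HolomorphicMatrixAt I (fun y => unipotentLog (f y)) x :=
  (hf.sub (const 1 x)).aeval _

theorem exp (hf : HolomorphicMatrixAt I f x) (hnil : ∀ y, IsNilpotent (f y)) :
    HolomorphicMatrixAt I (fun y => NormedSpace.exp (f y)) x := by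
  have hexp : ∀ y, NormedSpace.exp (f y) = _ := fun y =>
    exp_eq_sum_range_of_pow_eq_zero (K := ℂ) (pow_eq_zero_of_isNilpotent (hnil y))
  simp only [hexp]
  exact sum fun m _ => smul contMDiffAt_const (hf.pow m)

end HolomorphicMatrixAt

namespace ReductiveGroup

variable {F H : Type*} [NormedAddCommGroup F] [NormedSpace ℂ F]
  [TopologicalSpace H] [ChartedSpace F H] [Group H] (R : ReductiveGroup F H)

theorem contMDiffAt_iff {f : M → H} {x : M} :
    ContMDiffAt I 𝓘(ℂ, F) ω f x ↔ HolomorphicMatrixAt I (fun y => R.mat (f y)) x := by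
  have hentries : HolomorphicMatrixAt I (fun y => R.mat (f y)) x ↔
      ContMDiffAt I 𝓘(ℂ, Fin R.N → Fin R.N → ℂ) ω
        ((fun h a b => (R.ρ h : Matrix (Fin R.N) (Fin R.N) ℂ) a b) ∘ f) x := by
    simp only [contMDiffAt_pi_space]
    rfl
  rw [hentries, ContMDiffAt.iff_comp_isImmersionAt (R.embedding.isImmersion.isImmersionAt (f x)),
    and_iff_right_iff_imp, R.embedding.isEmbedding.isInducing.continuousAt_iff]
  exact ContMDiffAt.continuousAt

theorem continuous_mat : Continuous R.mat :=
  R.embedding.isEmbedding.continuous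

variable {R}

theorem IsExpLog.contMDiffAt {k : ℕ} {z : M → Fin k → ℂ} {u : M → Fin k → H} {c : M → H} {x : M}
    (hc : ∀ y, R.IsExpLog (z y) (u y) (c y)) (hu : ∀ y j, R.IsUnipotent (u y j))
    (hcomm : ∀ y i j, Commute (u y i) (u y j))
    (hz : ∀ j, ContMDiffAt I 𝓘(ℂ, ℂ) ω (fun y => z y j) x)
    (hu' : ∀ j, ContMDiffAt I 𝓘(ℂ, F) ω (fun y => u y j) x) :
    ContMDiffAt I 𝓘(ℂ, F) ω c x := by
  have hnil : ∀ y, IsNilpotent ((-1 / (2 * Real.pi * Complex.I) : ℂ) •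
      ∑ j, z y j • R.log (u y j)) := fun y =>
    (Commute.isNilpotent_sum (fun j _ => (hu y j).isNilpotent_log.smul _) fun i j _ _ =>
      ((R.commute_log (hcomm y i j)).smul_left _).smul_right _).smul _
  rw [R.contMDiffAt_iff]
  have hmat : (fun y => R.mat (c y)) = _ := funext fun y => hc y
  rw [hmat]
  refine HolomorphicMatrixAt.exp (.smul contMDiffAt_const (.sum fun j _ => .smul (hz j) ?_)) hnil
  simp only [log_eq_unipotentLog]
  exact (R.contMDiffAt_iff.mp (hu' j)).unipotentLog

end ReductiveGroup

end HolomorphicMatrices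

/-! ### Frames of principal bundles and arrows of the Atiyah groupoid -/

namespace PrincipalBundle

variable {E X F H : Type*}
  [NormedAddCommGroup E] [NormedSpace ℂ E] [NormedAddCommGroup F] [NormedSpace ℂ F]
  [TopologicalSpace X] [ChartedSpace E X] [TopologicalSpace H] [ChartedSpace F H] [Group H]
  (P : PrincipalBundle.{w} E X F H)

theorem act_injective (p : P.carrier) : Function.Injective (P.act p) := by
  intro h h' e
  obtain ⟨W, -, hxW, t, hsrc, -, -, ht, -⟩ := P.locally_trivial (P.proj p)
  have hp : p ∈ t.source := by rwa [hsrc]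
  have hmul : (t p).2 * h = (t p).2 * h' := by rw [← ht p hp h, e, ht p hp h']
  exact mul_left_cancel hmul

theorem exists_act_eq {p q : P.carrier} (e : P.proj p = P.proj q) : ∃ h, P.act p h = q := by
  obtain ⟨W, -, hxW, t, hsrc, -, hfst, ht, -⟩ := P.locally_trivial (P.proj p)
  have hp : p ∈ t.source := by rwa [hsrc]
  have hq : q ∈ t.source := by rwa [hsrc, Set.mem_preimage, ← e]
  have hph : ∀ h, P.act p h ∈ t.source := fun h => by
    rwa [hsrc, Set.mem_preimage, P.proj_act]
  refine ⟨(t p).2⁻¹ * (t q).2, t.injOn (hph _) hq (Prod.ext ?_ ?_)⟩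
  · rw [hfst _ (hph _), hfst _ hq, P.proj_act, e]
  · rw [ht p hp, mul_inv_cancel_left]

theorem proj_surjective : Function.Surjective P.proj := by
  intro x
  obtain ⟨W, -, hxW, t, -, htgt, hfst, -⟩ := P.locally_trivial x
  have hx : (x, (1 : H)) ∈ t.target := by rw [htgt]; exact ⟨hxW, trivial⟩
  exact ⟨t.symm (x, 1), by rw [← hfst _ (t.map_target hx), t.right_inv hx]⟩

open Classical in
/-- The element of the structure group that takes the frame `p` to the frame `q`; it is `1` by
convention when `p` and `q` lie in different fibres. -/
def div (p q : P.carrier) : H :=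
  if h : ∃ h, P.act p h = q then h.choose else 1

theorem act_div {p q : P.carrier} (e : P.proj p = P.proj q) : P.act p (P.div p q) = q := by
  have h := P.exists_act_eq e
  rw [div, dif_pos h]
  exact h.choose_spec

section Holomorphy

variable {EM HM M : Type*} [NormedAddCommGroup EM] [NormedSpace ℂ EM] [TopologicalSpace HM]
  {I : ModelWithCorners ℂ EM HM} [TopologicalSpace M] [ChartedSpace HM M] {x : M}

theorem contMDiffAt_act {a : M → P.carrier} {b : M → H}
    (ha : ContMDiffAt I (𝓘(ℂ, E).prod 𝓘(ℂ, F)) ω a x) (hb : ContMDiffAt I 𝓘(ℂ, F) ω b x) :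
    ContMDiffAt I (𝓘(ℂ, E).prod 𝓘(ℂ, F)) ω (fun y => P.act (a y) (b y)) x :=
  P.act_holomorphic.contMDiffAt.comp x (ha.prodMk hb)

theorem contMDiffAt_div [LieGroup 𝓘(ℂ, F) ω H] {a b : M → P.carrier}
    (ha : ContMDiffAt I (𝓘(ℂ, E).prod 𝓘(ℂ, F)) ω a x)
    (hb : ContMDiffAt I (𝓘(ℂ, E).prod 𝓘(ℂ, F)) ω b x)
    (hab : ∀ᶠ y in 𝓝 x, P.proj (a y) = P.proj (b y)) :
    ContMDiffAt I 𝓘(ℂ, F) ω (fun y => P.div (a y) (b y)) x := by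
  obtain ⟨W, -, hxW, t, hsrc, -, -, ht, hhol, -⟩ := P.locally_trivial (P.proj (a x))
  have hax : a x ∈ t.source := by rwa [hsrc]
  have hbx : b x ∈ t.source := by rwa [hsrc, Set.mem_preimage, ← hab.self_of_nhds]
  have hta := (hhol.contMDiffAt (t.open_source.mem_nhds hax)).comp x ha
  have htb := (hhol.contMDiffAt (t.open_source.mem_nhds hbx)).comp x hb
  have hquot := (contMDiffAt_snd.comp x hta).inv.mul (contMDiffAt_snd.comp x htb)
  refine hquot.congr_of_eventuallyEq ?_
  filter_upwards [hab, ha.continuousAt.preimage_mem_nhds (t.open_source.mem_nhds hax)]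
    with y hy hys
  have htb' : (t (b y)).2 = (t (a y)).2 * P.div (a y) (b y) := by
    rw [← ht (a y) hys, P.act_div hy]
  exact eq_inv_mul_of_mul_eq htb'.symm

end Holomorphy

variable {P}

theorem arrow_eq_iff {q p q' p' : P.carrier} :
    P.arrow q p = P.arrow q' p' ↔ ∃ h, q' = P.act q h ∧ p' = P.act p h :=
  (Quotient.eq (r := P.pairSetoid)).trans <| exists_congr fun _ => Prod.mk_inj

theorem arrow_act (q p : P.carrier) (h : H) : P.arrow (P.act q h) (P.act p h) = P.arrow q p :=
  (arrow_eq_iff.mpr ⟨h, rfl, rfl⟩).symm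

theorem arrow_left_injective (p : P.carrier) : Function.Injective fun q => P.arrow q p := by
  intro q q' e
  obtain ⟨h, rfl, hp⟩ := arrow_eq_iff.mp e
  have hone : h = 1 := P.act_injective p (by rw [← hp, P.act_one])
  rw [hone, P.act_one]

theorem arrow_eq_arrow_act_div {a b p : P.carrier} (hab : P.proj a = P.proj b)
    (hbp : P.proj b = P.proj p) :
    P.arrow a b = P.arrow (P.act p (P.div p (P.act a (P.div b p)))) p := by
  have hp := arrow_act a b (P.div b p)
  rw [P.act_div hbp] at hp
  rw [P.act_div (by rw [P.proj_act, hab, hbp]), hp]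

namespace Atiyah

@[simp] theorem src_arrow (q p : P.carrier) : (P.arrow q p).src = P.proj p := rfl

@[simp] theorem tgt_arrow (q p : P.carrier) : (P.arrow q p).tgt = P.proj q := rfl

@[simp] theorem inv_arrow (q p : P.carrier) : (P.arrow q p).inv = P.arrow p q := rfl

theorem exists_eq_arrow_of_src {a : P.Atiyah} {p : P.carrier} (h : a.src = P.proj p) :
    ∃ q, a = P.arrow q p := by
  induction a using Quotient.inductionOn with
  | h b =>
    obtain ⟨c, rfl⟩ := P.exists_act_eq (p := b.2) h
    exact ⟨P.act b.1 c, (arrow_act b.1 b.2 c).symm⟩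

theorem exists_eq_arrow_of_tgt {a : P.Atiyah} {q : P.carrier} (h : a.tgt = P.proj q) :
    ∃ p, a = P.arrow q p := by
  induction a using Quotient.inductionOn with
  | h b =>
    obtain ⟨c, rfl⟩ := P.exists_act_eq (p := b.1) h
    exact ⟨P.act b.2 c, (arrow_act b.1 b.2 c).symm⟩

theorem isComp_arrow (r q p : P.carrier) : (P.arrow r q).IsComp (P.arrow q p) (P.arrow r p) :=
  ⟨p, q, r, rfl, rfl, rfl⟩

theorem IsComp.eq_arrow {r q p : P.carrier} {c : P.Atiyah}
    (h : (P.arrow r q).IsComp (P.arrow q p) c) : c = P.arrow r p := by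
  obtain ⟨p', q', r', hrq, hqp, rfl⟩ := h
  obtain ⟨a, rfl, rfl⟩ := arrow_eq_iff.mp hrq
  obtain ⟨b, hb, rfl⟩ := arrow_eq_iff.mp hqp
  rw [P.act_injective _ hb, arrow_act]

end Atiyah

end PrincipalBundle

/-! ### Twisting a representation by unipotent gauge transformations -/

section Twist

variable {E EG X G F H : Type*}
  [NormedAddCommGroup E] [NormedSpace ℂ E] [NormedAddCommGroup EG] [NormedSpace ℂ EG]
  [NormedAddCommGroup F] [NormedSpace ℂ F]
  [TopologicalSpace X] [ChartedSpace E X] [TopologicalSpace G] [ChartedSpace EG G]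
  [TopologicalSpace H] [ChartedSpace F H] [Group H]

namespace RepOn

variable {𝒢 : HolLieGroupoid E EG X G} {P : PrincipalBundle.{w} E X F H} (φ : RepOn 𝒢 P)
  {g h : G} {r q p : P.carrier}

theorem exists_eq_arrow_of_src (hp : P.proj p = 𝒢.src g) : ∃ q, φ.toFun g = P.arrow q p :=
  PrincipalBundle.Atiyah.exists_eq_arrow_of_src ((φ.src_toFun g).trans hp.symm)

theorem exists_eq_arrow_of_tgt (hq : P.proj q = 𝒢.tgt g) : ∃ p, φ.toFun g = P.arrow q p :=
  PrincipalBundle.Atiyah.exists_eq_arrow_of_tgt ((φ.tgt_toFun g).trans hq.symm)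

theorem exists_eq_arrow (g : G) : ∃ q p, φ.toFun g = P.arrow q p :=
  let ⟨p, hp⟩ := P.proj_surjective (𝒢.src g)
  let ⟨q, hq⟩ := φ.exists_eq_arrow_of_src hp
  ⟨q, p, hq⟩

variable {φ}

theorem proj_eq_src (hg : φ.toFun g = P.arrow q p) : P.proj p = 𝒢.src g := by
  rw [← φ.src_toFun, hg, PrincipalBundle.Atiyah.src_arrow]

theorem proj_eq_tgt (hg : φ.toFun g = P.arrow q p) : P.proj q = 𝒢.tgt g := by
  rw [← φ.tgt_toFun, hg, PrincipalBundle.Atiyah.tgt_arrow]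

theorem toFun_mul (hgh : 𝒢.src g = 𝒢.tgt h) (hg : φ.toFun g = P.arrow r q)
    (hh : φ.toFun h = P.arrow q p) : φ.toFun (𝒢.mul g h) = P.arrow r p := by
  have hmul := φ.map_mul g h hgh
  rw [hg, hh] at hmul
  exact hmul.eq_arrow

end RepOn

variable {k : ℕ} [MulAction (Fin k → ℂˣ) X]

theorem HomogeneousGroupoid.tgt_i_lattice (𝒢 : HomogeneousGroupoid E EG X G k) (n : Fin k → ℤ)
    (x : X) : 𝒢.tgt (𝒢.i (lattice n, x)) = x := by
  rw [𝒢.tgt_i, expTorus_lattice, one_smul]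

theorem HomogeneousGroupoid.π_one (𝒢 : HomogeneousGroupoid E EG X G k) (x : X) :
    𝒢.π (𝒢.one x) = 0 := by
  rw [← 𝒢.i_zero, 𝒢.π_i]

/-- A homomorphism `U` from `ℤ^k` to the unipotent automorphisms of the representation `φ`, read in
frames: the value of `U_n` at the frame `p` is `p · u n p`. -/
structure UnipotentFamily {𝒢 : HomogeneousGroupoid E EG X G k} (R : ReductiveGroup F H)
    {P : PrincipalBundle.{w} E X F H} (φ : RepOn 𝒢.toHolLieGroupoid P) where
  /-- the element of the structure group representing `U_n` in a frame -/
  u : (Fin k → ℤ) → P.carrier → H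
  map_add : ∀ n n' p, u (n + n') p = u n p * u n' p
  conj : ∀ n p h, u n (P.act p h) = h⁻¹ * u n p * h
  holomorphic : ∀ n, ContMDiff (𝓘(ℂ, E).prod 𝓘(ℂ, F)) 𝓘(ℂ, F) ω (u n)
  invariant : ∀ n g q p, φ.toFun g = P.arrow q p → u n q = u n p
  unipotent : ∀ n p, R.IsUnipotent (u n p)

namespace UnipotentFamily

variable {𝒢 : HomogeneousGroupoid E EG X G k} {R : ReductiveGroup F H}
  {P : PrincipalBundle.{w} E X F H} {φ : RepOn 𝒢.toHolLieGroupoid P}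
  (U : UnipotentFamily R φ)

/-- The homomorphism `n ↦ U_n` in the frame `p`. -/
def monoidHom (p : P.carrier) : Multiplicative (Fin k → ℤ) →* H :=
  MonoidHom.mk' (fun n => U.u n.toAdd p) fun _ _ => U.map_add _ _ p

theorem commute (n n' : Fin k → ℤ) (p : P.carrier) : Commute (U.u n p) (U.u n' p) :=
  (Commute.all (Multiplicative.ofAdd n) (.ofAdd n')).map (U.monoidHom p)

theorem map_zero (p : P.carrier) : U.u 0 p = 1 :=
  map_one (U.monoidHom p)

theorem u_act_of_commute {n : Fin k → ℤ} {p : P.carrier} {h : H} (hc : Commute (U.u n p) h) :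
    U.u n (P.act p h) = U.u n p := by
  rw [U.conj, mul_assoc, hc.eq, inv_mul_cancel_left]

theorem exists_frameCocycle (g : G) (q : P.carrier) :
    ∃ c : H, R.IsExpLog (𝒢.π g) (fun j => U.u (Pi.single j 1) q) c :=
  R.exists_isExpLog _ (fun _ => U.unipotent _ _) fun _ _ => U.commute _ _ _

/-- The value of the exponential section `σ_U` at `g`, read in the frame `q`. -/
def frameCocycle (g : G) (q : P.carrier) : H := (U.exists_frameCocycle g q).choose

theorem isExpLog_frameCocycle (g : G) (q : P.carrier) :
    R.IsExpLog (𝒢.π g) (fun j => U.u (Pi.single j 1) q) (U.frameCocycle g q) :=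
  (U.exists_frameCocycle g q).choose_spec

theorem frameCocycle_eq {g : G} {q : P.carrier} {c : H}
    (h : R.IsExpLog (𝒢.π g) (fun j => U.u (Pi.single j 1) q) c) : U.frameCocycle g q = c :=
  (U.isExpLog_frameCocycle g q).unique h

theorem frameCocycle_act (g : G) (q : P.carrier) (h : H) :
    U.frameCocycle g (P.act q h) = h⁻¹ * U.frameCocycle g q * h := by
  refine U.frameCocycle_eq ?_
  simp only [U.conj]
  exact (U.isExpLog_frameCocycle g q).conj h

theorem frameCocycle_invariant (g : G) {g' : G} {q p : P.carrier}
    (h : φ.toFun g' = P.arrow q p) : U.frameCocycle g q = U.frameCocycle g p := by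
  refine U.frameCocycle_eq ?_
  simp only [U.invariant _ _ _ _ h]
  exact U.isExpLog_frameCocycle g p

theorem frameCocycle_mul {g h : G} (hgh : 𝒢.src g = 𝒢.tgt h) (q : P.carrier) :
    U.frameCocycle (𝒢.mul g h) q = U.frameCocycle g q * U.frameCocycle h q := by
  refine U.frameCocycle_eq ?_
  rw [𝒢.π_mul g h hgh]
  exact (U.isExpLog_frameCocycle g q).add (fun _ _ => U.commute _ _ _)
    (U.isExpLog_frameCocycle h q)

theorem frameCocycle_one (x : X) (q : P.carrier) : U.frameCocycle (𝒢.one x) q = 1 := by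
  refine U.frameCocycle_eq ?_
  rw [𝒢.π_one]
  exact ReductiveGroup.isExpLog_zero _

theorem commute_frameCocycle {a : H} {q : P.carrier} (g : G) (h : ∀ n, Commute a (U.u n q)) :
    Commute a (U.frameCocycle g q) :=
  (U.isExpLog_frameCocycle g q).commute fun _ => h _

theorem frameCocycle_lattice (n : Fin k → ℤ) (x : X) (q : P.carrier) :
    U.frameCocycle (𝒢.i (lattice n, x)) q = (U.u n q)⁻¹ := by
  refine U.frameCocycle_eq ?_
  rw [𝒢.π_i]
  exact ReductiveGroup.isExpLog_lattice (U.monoidHom q) (fun n => U.unipotent n.toAdd q) n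

theorem contMDiffOn_act_frameCocycle {S : Set G} (hS : IsOpen S) {a : G → P.carrier}
    (ha : ContMDiffOn 𝓘(ℂ, EG) (𝓘(ℂ, E).prod 𝓘(ℂ, F)) ω a S) :
    ContMDiffOn 𝓘(ℂ, EG) (𝓘(ℂ, E).prod 𝓘(ℂ, F)) ω
      (fun g => P.act (a g) (U.frameCocycle g (a g))) S := by
  intro g hg
  have hag := ha.contMDiffAt (hS.mem_nhds hg)
  refine (P.contMDiffAt_act hag ?_).contMDiffWithinAt
  exact ReductiveGroup.IsExpLog.contMDiffAt (fun y => U.isExpLog_frameCocycle y (a y))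
    (fun _ _ => U.unipotent _ _) (fun _ _ _ => U.commute _ _ _)
    (contMDiffAt_pi_space.mp 𝒢.π_holomorphic.contMDiffAt)
    fun _ => (U.holomorphic _).contMDiffAt.comp g hag

theorem act_frameCocycle_act (g : G) (q : P.carrier) (h : H) :
    P.act (P.act q h) (U.frameCocycle g (P.act q h)) =
      P.act (P.act q (U.frameCocycle g q)) h := by
  rw [U.frameCocycle_act, ← P.act_mul, ← P.act_mul, mul_assoc, mul_inv_cancel_left]

/-- The section `σ_U` of the isotropy of the Atiyah groupoid, pulled back by the target map. -/
def cocycle (g : G) : P.Atiyah :=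
  Quotient.liftOn (φ.toFun g) (fun b => P.arrow (P.act b.1 (U.frameCocycle g b.1)) b.1) (by
    rintro a b ⟨h, rfl⟩
    simp only [U.act_frameCocycle_act, PrincipalBundle.arrow_act])

theorem cocycle_eq {g : G} {q : P.carrier} (hq : P.proj q = 𝒢.tgt g) :
    U.cocycle g = P.arrow (P.act q (U.frameCocycle g q)) q := by
  obtain ⟨p, hp⟩ := φ.exists_eq_arrow_of_tgt hq
  rw [cocycle, hp]
  rfl

theorem isOneCocycle_cocycle : IsOneCocycle φ U.cocycle where
  src_eq g := by
    obtain ⟨q, hq⟩ := P.proj_surjective (𝒢.tgt g)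
    rw [U.cocycle_eq hq, PrincipalBundle.Atiyah.src_arrow, hq]
  tgt_eq g := by
    obtain ⟨q, hq⟩ := P.proj_surjective (𝒢.tgt g)
    rw [U.cocycle_eq hq, PrincipalBundle.Atiyah.tgt_arrow, P.proj_act, hq]
  holomorphic g₀ := by
    obtain ⟨S, hS, hg₀, a, b, ha, -, hab⟩ := φ.holomorphic g₀
    exact ⟨S, hS, hg₀, fun g => P.act (a g) (U.frameCocycle g (a g)), a,
      U.contMDiffOn_act_frameCocycle hS ha, ha,
      fun g hg => U.cocycle_eq (RepOn.proj_eq_tgt (hab g hg))⟩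
  cocycle g h hgh := by
    obtain ⟨r, q, hrq⟩ := φ.exists_eq_arrow g
    have hr : P.proj r = 𝒢.tgt g := RepOn.proj_eq_tgt hrq
    have hq : P.proj q = 𝒢.tgt h := (RepOn.proj_eq_src hrq).trans hgh
    refine ⟨P.arrow (P.act r (U.frameCocycle g r)) q,
      P.arrow (P.act (P.act r (U.frameCocycle g r)) (U.frameCocycle h q)) q, ?_, ?_, ?_⟩
    · rw [hrq, U.cocycle_eq hr]
      exact PrincipalBundle.Atiyah.isComp_arrow _ _ _
    · rw [U.cocycle_eq hq, ← PrincipalBundle.arrow_act _ q (U.frameCocycle h q)]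
      exact PrincipalBundle.Atiyah.isComp_arrow _ _ _
    · rw [hrq, PrincipalBundle.Atiyah.inv_arrow, U.cocycle_eq (hr.trans (𝒢.tgt_mul g h hgh).symm),
        U.frameCocycle_mul hgh, P.act_mul, U.frameCocycle_invariant h hrq]
      exact PrincipalBundle.Atiyah.isComp_arrow _ _ _

/-- The underlying map of the representation `σ_U φ`. -/
def twistFun (g : G) : P.Atiyah :=
  Quotient.liftOn (φ.toFun g) (fun b => P.arrow (P.act b.1 (U.frameCocycle g b.1)) b.2) (by
    rintro a b ⟨h, rfl⟩
    simp only [U.act_frameCocycle_act, PrincipalBundle.arrow_act])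

theorem twistFun_eq {g : G} {q p : P.carrier} (h : φ.toFun g = P.arrow q p) :
    U.twistFun g = P.arrow (P.act q (U.frameCocycle g q)) p := by
  rw [twistFun, h]
  rfl

/-- The representation `σ_U φ`. -/
def twist : RepOn 𝒢.toHolLieGroupoid P where
  toFun := U.twistFun
  src_toFun g := by
    obtain ⟨q, p, h⟩ := φ.exists_eq_arrow g
    rw [U.twistFun_eq h, PrincipalBundle.Atiyah.src_arrow, RepOn.proj_eq_src h]
  tgt_toFun g := by
    obtain ⟨q, p, h⟩ := φ.exists_eq_arrow g
    rw [U.twistFun_eq h, PrincipalBundle.Atiyah.tgt_arrow, P.proj_act, RepOn.proj_eq_tgt h]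
  map_one p := by
    rw [U.twistFun_eq (φ.map_one p), U.frameCocycle_one, P.act_one]
  map_mul g h hgh := by
    obtain ⟨q, p, hqp⟩ := φ.exists_eq_arrow h
    obtain ⟨r, hrq⟩ := φ.exists_eq_arrow_of_src ((RepOn.proj_eq_tgt hqp).trans hgh.symm)
    rw [U.twistFun_eq (RepOn.toFun_mul hgh hrq hqp), U.twistFun_eq hqp, U.twistFun_eq hrq,
      U.frameCocycle_mul hgh, P.act_mul, U.frameCocycle_invariant h hrq,
      ← PrincipalBundle.arrow_act _ q (U.frameCocycle h q)]
    exact PrincipalBundle.Atiyah.isComp_arrow _ _ _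
  holomorphic g₀ := by
    obtain ⟨S, hS, hg₀, a, b, ha, hb, hab⟩ := φ.holomorphic g₀
    exact ⟨S, hS, hg₀, fun g => P.act (a g) (U.frameCocycle g (a g)), b,
      U.contMDiffOn_act_frameCocycle hS ha, hb, fun g hg => U.twistFun_eq (hab g hg)⟩

theorem twist_eq {g : G} {q p : P.carrier} (h : φ.toFun g = P.arrow q p) :
    U.twist.toFun g = P.arrow (P.act q (U.frameCocycle g q)) p :=
  U.twistFun_eq h

theorem isTwist {V : (Fin k → ℤ) → P.carrier → P.carrier}
    (hV : ∀ n q, V n q = P.act q (U.u n q)) : IsTwist 𝒢 R V φ U.twist := by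
  refine ⟨U.cocycle, U.isOneCocycle_cocycle, fun g q hq => ?_, fun g => ?_⟩
  · exact ⟨fun j => U.u (Pi.single j 1) q, U.frameCocycle g q, fun j => hV _ _,
      U.isExpLog_frameCocycle g q, U.cocycle_eq hq⟩
  · obtain ⟨q, p, h⟩ := φ.exists_eq_arrow g
    rw [U.cocycle_eq (RepOn.proj_eq_tgt h), U.twist_eq h, h]
    exact PrincipalBundle.Atiyah.isComp_arrow _ _ _

theorem monodromy_twist {n : Fin k → ℤ} {p : P.carrier} {m : H}
    (h : monodromy 𝒢 φ n (P.proj p) = P.arrow (P.act p m) p) :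
    monodromy 𝒢 U.twist n (P.proj p) = P.arrow (P.act p (m * (U.u n p)⁻¹)) p := by
  rw [monodromy, U.twist_eq h, U.frameCocycle_lattice, U.invariant _ _ _ _ h, P.act_mul]

/-- The family `n ↦ U_n⁻¹`. -/
def inv [LieGroup 𝓘(ℂ, F) ω H] : UnipotentFamily R φ where
  u n p := (U.u n p)⁻¹
  map_add n n' p := by rw [U.map_add, (U.commute n n' p).eq, mul_inv_rev]
  conj n p h := by
    rw [U.conj]
    group
  holomorphic n := (U.holomorphic n).inv
  invariant n g q p h := by rw [U.invariant n g q p h]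
  unipotent n p := (U.unipotent n p).inv

/-- A family `V` commuting with `U`, as a family of automorphisms of the representation `σ_U φ`. -/
def transfer (V : UnipotentFamily R φ) (h : ∀ n n' p, Commute (V.u n p) (U.u n' p)) :
    UnipotentFamily R U.twist where
  u := V.u
  map_add := V.map_add
  conj := V.conj
  holomorphic := V.holomorphic
  unipotent := V.unipotent
  invariant n g q p hqp := by
    obtain ⟨q₀, hq₀⟩ := φ.exists_eq_arrow_of_src (RepOn.proj_eq_src hqp)
    rw [U.twist_eq hq₀] at hqp
    rw [← PrincipalBundle.arrow_left_injective p hqp,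
      V.u_act_of_commute (U.commute_frameCocycle g fun n' => h n n' q₀), V.invariant _ _ _ _ hq₀]

theorem twist_twist_of_inv (V : UnipotentFamily R U.twist)
    (h : ∀ n p, V.u n p = (U.u n p)⁻¹) : V.twist = φ := by
  ext g
  obtain ⟨q, p, hqp⟩ := φ.exists_eq_arrow g
  have hcancel : V.frameCocycle g (P.act q (U.frameCocycle g q)) = (U.frameCocycle g q)⁻¹ := by
    refine V.frameCocycle_eq ?_
    simp only [h, U.u_act_of_commute (U.commute_frameCocycle g fun n' => U.commute _ n' q)]
    exact (U.isExpLog_frameCocycle g q).inv fun _ => U.unipotent _ _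
  rw [V.twist_eq (U.twist_eq hqp), hcancel, ← P.act_mul, mul_inv_cancel, P.act_one, hqp]

end UnipotentFamily

end Twist

/-! ### Monodromy -/

section Monodromy

variable {E EG X G F H : Type*}
  [NormedAddCommGroup E] [NormedSpace ℂ E] [NormedAddCommGroup EG] [NormedSpace ℂ EG]
  [NormedAddCommGroup F] [NormedSpace ℂ F]
  [TopologicalSpace X] [ChartedSpace E X] [TopologicalSpace G] [ChartedSpace EG G]
  [TopologicalSpace H] [ChartedSpace F H] [Group H]

theorem HolLieGroupoid.SEquiv.map_eq {𝒢 : HolLieGroupoid E EG X G} {Y : Type*}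
    [TopologicalSpace Y] [T2Space Y] {f : X → Y} (hf : Continuous f)
    (hinv : ∀ g, f (𝒢.tgt g) = f (𝒢.src g)) {x y : X} (h : 𝒢.SEquiv x y) : f x = f y := by
  have horbit : ∀ x, ∀ y ∈ 𝒢.orbit x, f y = f x := by
    rintro _ _ ⟨g, rfl, rfl⟩
    exact hinv g
  have hclosure : ∀ x, ∀ y ∈ closure (𝒢.orbit x), f y = f x := fun x =>
    closure_minimal (horbit x) (isClosed_eq hf continuous_const)
  induction h with
  | rel x y h =>
    obtain ⟨z, hzx, hzy⟩ := h
    rw [← hclosure x z hzx, hclosure y z hzy]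
  | refl x => rfl
  | symm x y _ ih => exact ih.symm
  | trans x y z _ _ ih ih' => exact ih.trans ih'

theorem PrincipalBundle.isQuotientMap_proj (P : PrincipalBundle.{w} E X F H) :
    Topology.IsQuotientMap P.proj := by
  refine ⟨.of_isOpen_preimage_iff_isOpen fun S =>
    ⟨fun hS => ?_, fun hS => hS.preimage P.proj_holomorphic.continuous⟩, P.proj_surjective⟩
  refine isOpen_iff_mem_nhds.mpr fun x hx => ?_
  obtain ⟨W, hW, hxW, t, -, htgt, hfst, -⟩ := P.locally_trivial x
  have hmem : ∀ y ∈ W, (y, (1 : H)) ∈ t.target := fun y hy => htgt ▸ ⟨hy, trivial⟩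
  have hsection : ∀ y ∈ W, P.proj (t.symm (y, 1)) = y := fun y hy => by
    rw [← hfst _ (t.map_target (hmem y hy)), t.right_inv (hmem y hy)]
  have hcont : ContinuousAt (fun y : X => t.symm (y, (1 : H))) x :=
    (t.symm.continuousAt (hmem x hxW)).comp_of_eq (f := fun y : X => (y, (1 : H)))
      (by fun_prop) rfl
  have hxS : P.proj ⁻¹' S ∈ 𝓝 (t.symm (x, (1 : H))) :=
    hS.mem_nhds (by rwa [Set.mem_preimage, hsection x hxW])
  filter_upwards [hcont hxS, hW.mem_nhds hxW] with y hyS hyW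
  rwa [Set.mem_preimage, Set.mem_preimage, hsection y hyW] at hyS

namespace RepOn

theorem eq_of_continuous_of_invariant {𝒢 : HolLieGroupoid E EG X G}
    {P : PrincipalBundle.{w} E X F H} (φ : RepOn 𝒢 P) {Y : Type*} [TopologicalSpace Y]
    [T2Space Y] {f : P.carrier → Y} (hf : Continuous f) (hact : ∀ p h, f (P.act p h) = f p)
    (hinv : ∀ g q p, φ.toFun g = P.arrow q p → f q = f p) {p q : P.carrier}
    (h : 𝒢.SEquiv (P.proj p) (P.proj q)) : f p = f q := by
  have hfactor : ∀ p q, P.proj p = P.proj q → f p = f q := fun p q e => by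
    obtain ⟨a, rfl⟩ := P.exists_act_eq e
    exact (hact p a).symm
  let σ := Function.surjInv P.proj_surjective
  have hσ : ∀ x, P.proj (σ x) = x := Function.surjInv_eq P.proj_surjective
  have hbase : f ∘ σ ∘ P.proj = f := funext fun p => hfactor _ _ (hσ (P.proj p))
  have hcont : Continuous (f ∘ σ) := by
    rwa [P.isQuotientMap_proj.continuous_iff, Function.comp_assoc, hbase]
  have hconst : f (σ (P.proj p)) = f (σ (P.proj q)) := by
    refine h.map_eq hcont fun g => ?_
    obtain ⟨q, hq⟩ := φ.exists_eq_arrow_of_src (hσ (𝒢.src g))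
    exact (hfactor _ _ ((hσ _).trans (proj_eq_tgt hq).symm)).trans (hinv g q _ hq)
  exact (congrFun hbase p).symm.trans (hconst.trans (congrFun hbase q))

variable {k : ℕ} [MulAction (Fin k → ℂˣ) X]
  {𝒢 : HomogeneousGroupoid E EG X G k} {P : PrincipalBundle.{w} E X F H}
  (φ : RepOn 𝒢.toHolLieGroupoid P)

theorem exists_monodromy_eq (n : Fin k → ℤ) (p : P.carrier) :
    ∃ m : H, monodromy 𝒢 φ n (P.proj p) = P.arrow (P.act p m) p := by
  obtain ⟨q, hq⟩ :=
    φ.exists_eq_arrow_of_src (g := 𝒢.i (lattice n, P.proj p)) (𝒢.src_i _ _).symm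
  have hqp : P.proj q = P.proj p := (proj_eq_tgt hq).trans (𝒢.tgt_i_lattice _ _)
  obtain ⟨m, rfl⟩ := P.exists_act_eq hqp.symm
  exact ⟨m, hq⟩

/-- The monodromy `M_n` read in the frame `p`. -/
def frameMonodromy (n : Fin k → ℤ) (p : P.carrier) : H := (φ.exists_monodromy_eq n p).choose

theorem monodromy_eq (n : Fin k → ℤ) (p : P.carrier) :
    monodromy 𝒢 φ n (P.proj p) = P.arrow (P.act p (φ.frameMonodromy n p)) p :=
  (φ.exists_monodromy_eq n p).choose_spec

variable {φ} in
theorem frameMonodromy_eq {n : Fin k → ℤ} {p : P.carrier} {m : H}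
    (h : monodromy 𝒢 φ n (P.proj p) = P.arrow (P.act p m) p) : φ.frameMonodromy n p = m :=
  P.act_injective p (PrincipalBundle.arrow_left_injective p ((φ.monodromy_eq n p).symm.trans h))

theorem frameMonodromy_act (n : Fin k → ℤ) (p : P.carrier) (h : H) :
    φ.frameMonodromy n (P.act p h) = h⁻¹ * φ.frameMonodromy n p * h := by
  refine frameMonodromy_eq ?_
  rw [P.proj_act, φ.monodromy_eq, ← PrincipalBundle.arrow_act _ p h, ← P.act_mul, ← P.act_mul,
    mul_assoc, mul_inv_cancel_left]

theorem frameMonodromy_add (n n' : Fin k → ℤ) (p : P.carrier) :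
    φ.frameMonodromy (n + n') p = φ.frameMonodromy n p * φ.frameMonodromy n' p := by
  refine frameMonodromy_eq ?_
  rw [monodromy, lattice_add, 𝒢.i_add, expTorus_lattice, one_smul, P.act_mul]
  refine toFun_mul ?_ ?_ (φ.monodromy_eq n' p)
  · rw [𝒢.src_i, 𝒢.tgt_i_lattice]
  · rw [PrincipalBundle.arrow_act]
    exact φ.monodromy_eq n p

theorem commute_frameMonodromy (n n' : Fin k → ℤ) (p : P.carrier) :
    Commute (φ.frameMonodromy n p) (φ.frameMonodromy n' p) := by
  rw [Commute, SemiconjBy, ← frameMonodromy_add, ← frameMonodromy_add, add_comm]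

theorem frameMonodromy_invariant (n : Fin k → ℤ) {g : G} {q p : P.carrier}
    (h : φ.toFun g = P.arrow q p) : φ.frameMonodromy n q = φ.frameMonodromy n p := by
  have hleft : φ.toFun (𝒢.mul (𝒢.i (lattice n, 𝒢.tgt g)) g) =
      P.arrow (P.act q (φ.frameMonodromy n q)) p := by
    refine toFun_mul (𝒢.src_i _ _) ?_ h
    rw [← proj_eq_tgt h]
    exact φ.monodromy_eq n q
  have hright : φ.toFun (𝒢.mul g (𝒢.i (lattice n, 𝒢.src g))) =
      P.arrow (P.act q (φ.frameMonodromy n p)) p := by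
    refine toFun_mul (𝒢.tgt_i_lattice _ _).symm (q := P.act p (φ.frameMonodromy n p)) ?_ ?_
    · rw [PrincipalBundle.arrow_act, h]
    · rw [← proj_eq_src h]
      exact φ.monodromy_eq n p
  rw [𝒢.central, hright] at hleft
  exact (P.act_injective q (PrincipalBundle.arrow_left_injective p hleft)).symm

variable [LieGroup 𝓘(ℂ, F) ω H]

theorem contMDiff_frameMonodromy (n : Fin k → ℤ) :
    ContMDiff (𝓘(ℂ, E).prod 𝓘(ℂ, F)) 𝓘(ℂ, F) ω (φ.frameMonodromy n) := by
  intro p₀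
  let γ : P.carrier → G := fun p => 𝒢.i (lattice n, P.proj p)
  have hγ : ContMDiff (𝓘(ℂ, E).prod 𝓘(ℂ, F)) 𝓘(ℂ, EG) ω γ :=
    𝒢.i_holomorphic.comp (contMDiff_const.prodMk P.proj_holomorphic)
  obtain ⟨S, hS, hp₀, a, b, ha, hb, hab⟩ := φ.holomorphic (γ p₀)
  have haγ := (ha.contMDiffAt (hS.mem_nhds hp₀)).comp p₀ hγ.contMDiffAt
  have hbγ := (hb.contMDiffAt (hS.mem_nhds hp₀)).comp p₀ hγ.contMDiffAt
  have hnear : ∀ᶠ p in 𝓝 p₀, γ p ∈ S :=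
    hγ.continuous.continuousAt.preimage_mem_nhds (hS.mem_nhds hp₀)
  have hbp : ∀ p, γ p ∈ S → P.proj (b (γ p)) = P.proj p := fun p hp =>
    (proj_eq_src (hab _ hp)).trans (𝒢.src_i _ _)
  have hap : ∀ p, γ p ∈ S → P.proj (a (γ p)) = P.proj p := fun p hp =>
    (proj_eq_tgt (hab _ hp)).trans (𝒢.tgt_i_lattice _ _)
  have hdiv := P.contMDiffAt_div hbγ contMDiffAt_id (hnear.mono hbp)
  have hm := P.contMDiffAt_div contMDiffAt_id (P.contMDiffAt_act haγ hdiv)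
    (hnear.mono fun p hp => by
      rw [P.proj_act]
      exact (hap p hp).symm)
  refine hm.congr_of_eventuallyEq (hnear.mono fun p hp => frameMonodromy_eq ?_)
  exact (hab _ hp).trans
    (PrincipalBundle.arrow_eq_arrow_act_div ((hap p hp).trans (hbp p hp).symm) (hbp p hp))

theorem charpoly_frameMonodromy_eq (R : ReductiveGroup F H) (n : Fin k → ℤ) (p q : P.carrier) :
    (R.mat (φ.frameMonodromy n p)).charpoly = (R.mat (φ.frameMonodromy n q)).charpoly := by
  refine Polynomial.funext fun l => ?_
  have hcont : Continuous fun p => (R.mat (φ.frameMonodromy n p)).charpoly.eval l := by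
    simp only [Matrix.eval_charpoly]
    exact (continuous_const.sub
      (R.continuous_mat.comp (φ.contMDiff_frameMonodromy n).continuous)).matrix_det
  refine φ.eq_of_continuous_of_invariant hcont (fun p h => ?_) (fun g q p h => ?_)
    (𝒢.sEquiv_unique _ _)
  · rw [φ.frameMonodromy_act, R.charpoly_mat_conj]
  · rw [φ.frameMonodromy_invariant n h]

-- The characteristic polynomial being constant, one polynomial gives the semisimple part at all
-- points, so that this part is holomorphic.
theorem contMDiff_semisimplePart_frameMonodromy (R : ReductiveGroup F H) (n : Fin k → ℤ) :
    ContMDiff (𝓘(ℂ, E).prod 𝓘(ℂ, F)) 𝓘(ℂ, F) ω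
      fun p => R.semisimplePart (φ.frameMonodromy n p) := by
  intro p₀
  obtain ⟨f, hf⟩ := R.exists_mat_semisimplePart_eq_aeval
    (R.mat (φ.frameMonodromy n p₀)).charpoly_monic.ne_zero
  have hmat : ∀ p, R.mat (R.semisimplePart (φ.frameMonodromy n p)) =
      aeval (R.mat (φ.frameMonodromy n p)) f := fun p =>
    hf _ (φ.charpoly_frameMonodromy_eq R n p p₀)
  rw [R.contMDiffAt_iff]
  simp only [hmat]
  exact (R.contMDiffAt_iff.mp (φ.contMDiff_frameMonodromy n p₀)).aeval f

theorem contMDiff_unipotentPart_frameMonodromy (R : ReductiveGroup F H) (n : Fin k → ℤ) :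
    ContMDiff (𝓘(ℂ, E).prod 𝓘(ℂ, F)) 𝓘(ℂ, F) ω
      fun p => R.unipotentPart (φ.frameMonodromy n p) := by
  have hquot : (fun p => R.unipotentPart (φ.frameMonodromy n p)) =
      fun p => (R.semisimplePart (φ.frameMonodromy n p))⁻¹ * φ.frameMonodromy n p :=
    funext fun p => eq_inv_mul_of_mul_eq (R.isJordanChevalley_parts _).2.2.1.symm
  rw [hquot]
  exact (φ.contMDiff_semisimplePart_frameMonodromy R n).inv.mul (φ.contMDiff_frameMonodromy n)

/-- The family of unipotent components `U_n` of the monodromy of `φ`. -/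
def unipotentMonodromy (R : ReductiveGroup F H) : UnipotentFamily R φ where
  u n p := R.unipotentPart (φ.frameMonodromy n p)
  map_add n n' p := by
    rw [φ.frameMonodromy_add]
    exact ((R.isJordanChevalley_parts _).mul (R.isJordanChevalley_parts _)
      (φ.commute_frameMonodromy n n' p)).unipotentPart_eq
  conj n p h := by
    rw [φ.frameMonodromy_act]
    exact ((R.isJordanChevalley_parts _).conj h).unipotentPart_eq
  holomorphic n := φ.contMDiff_unipotentPart_frameMonodromy R n
  invariant n g q p h := by rw [φ.frameMonodromy_invariant n h]
  unipotent n p := (R.isJordanChevalley_parts _).2.1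

end RepOn

end Monodromy

/-! ### The isomorphism of categories -/

section Functors

variable {E EG X G F H : Type*}
  [NormedAddCommGroup E] [NormedSpace ℂ E] [NormedAddCommGroup EG] [NormedSpace ℂ EG]
  [NormedAddCommGroup F] [NormedSpace ℂ F]
  [TopologicalSpace X] [ChartedSpace E X] [TopologicalSpace G] [ChartedSpace EG G]
  [TopologicalSpace H] [ChartedSpace F H] [Group H]

namespace GRep

variable {𝒢 : HolLieGroupoid E EG X G} {A : GRep.{w} F H 𝒢}

theorem hom_ext {B : GRep.{w} F H 𝒢} {f f' : A ⟶ B}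
    (h : ∀ p, f.map.toFun p = f'.map.toFun p) : f = f' :=
  GRep.Hom.ext (PrincipalBundle.Hom.ext (funext h))

theorem hom_heq {A' B B' : GRep.{w} F H 𝒢} (hA : A = A') (hB : B = B') {f : A ⟶ B}
    {f' : A' ⟶ B'} (h : HEq f.map f'.map) : HEq f f' := by
  subst hA hB
  exact heq_of_eq (GRep.Hom.ext (eq_of_heq h))

theorem autFun_mul (u v : Aut A) (p : A.P.carrier) : autFun (u * v) p = autFun u (autFun v p) :=
  rfl

theorem autFun_act (u : Aut A) (p : A.P.carrier) (h : H) :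
    autFun u (A.P.act p h) = A.P.act (autFun u p) h :=
  u.hom.map.toFun_act p h

theorem proj_autFun (u : Aut A) (p : A.P.carrier) : A.P.proj (autFun u p) = A.P.proj p :=
  u.hom.map.proj_toFun p

/-- The element of the structure group representing an automorphism `u` in the frame `p`, so that
`u` sends `p` to `p · autFrame u p`. -/
def autFrame (u : Aut A) (p : A.P.carrier) : H := A.P.div p (autFun u p)

theorem act_autFrame (u : Aut A) (p : A.P.carrier) : A.P.act p (autFrame u p) = autFun u p :=
  A.P.act_div (proj_autFun u p).symm

theorem autFrame_eq {u : Aut A} {p : A.P.carrier} {h : H} (e : autFun u p = A.P.act p h) :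
    autFrame u p = h :=
  A.P.act_injective p ((act_autFrame u p).trans e)

theorem autFrame_act (u : Aut A) (p : A.P.carrier) (h : H) :
    autFrame u (A.P.act p h) = h⁻¹ * autFrame u p * h := by
  refine autFrame_eq ?_
  rw [autFun_act, ← act_autFrame u p, ← A.P.act_mul, ← A.P.act_mul, mul_assoc,
    mul_inv_cancel_left]

theorem autFrame_mul (u v : Aut A) (p : A.P.carrier) :
    autFrame (u * v) p = autFrame u p * autFrame v p := by
  refine autFrame_eq ?_
  rw [autFun_mul, ← act_autFrame v p, autFun_act, ← act_autFrame u p, A.P.act_mul]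

theorem contMDiff_autFrame [LieGroup 𝓘(ℂ, F) ω H] (u : Aut A) :
    ContMDiff (𝓘(ℂ, E).prod 𝓘(ℂ, F)) 𝓘(ℂ, F) ω (autFrame u) := fun p =>
  A.P.contMDiffAt_div contMDiffAt_id (u.hom.map.holomorphic p)
    (.of_forall fun p => (proj_autFun u p).symm)

theorem autFrame_invariant (u : Aut A) {g : G} {q p : A.P.carrier}
    (h : A.φ.toFun g = A.P.arrow q p) : autFrame u q = autFrame u p := by
  have hu : A.φ.toFun g = A.P.arrow (autFun u q) (autFun u p) := u.hom.intertwines g q p h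
  obtain ⟨a, hq, hp⟩ := PrincipalBundle.arrow_eq_iff.mp (h.symm.trans hu)
  rw [autFrame_eq hq, autFrame_eq hp]

end GRep

variable {k : ℕ} [MulAction (Fin k → ℂˣ) X]
  {𝒢 : HomogeneousGroupoid E EG X G k} {R : ReductiveGroup F H}

namespace UnipotentFamily

variable {P : PrincipalBundle.{w} E X F H} {φ : RepOn 𝒢.toHolLieGroupoid P}
  (U : UnipotentFamily R φ)

/-- The bundle map `U_n`, as an endomorphism of the representation. -/
def hom (n : Fin k → ℤ) : GRep.mk P φ ⟶ GRep.mk P φ :=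
  GRep.Hom.mk
    (PrincipalBundle.Hom.mk (fun p => P.act p (U.u n p))
      (fun p => P.contMDiffAt_act contMDiffAt_id (U.holomorphic n p))
      (fun p => P.proj_act _ _)
      (fun p h => by rw [U.conj, ← P.act_mul, ← P.act_mul, mul_assoc, mul_inv_cancel_left]))
    (fun g q p h => by
      change φ.toFun g = P.arrow (P.act q (U.u n q)) (P.act p (U.u n p))
      rw [U.invariant n g q p h, PrincipalBundle.arrow_act]
      exact h)

theorem hom_comp_hom (n n' : Fin k → ℤ) : U.hom n ≫ U.hom n' = U.hom (n' + n) := by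
  refine GRep.hom_ext fun p => ?_
  change P.act (P.act p (U.u n p)) (U.u n' (P.act p (U.u n p))) = P.act p (U.u (n' + n) p)
  rw [U.u_act_of_commute (U.commute _ _ _), ← P.act_mul, ← U.map_add, add_comm]

theorem hom_zero : U.hom 0 = 𝟙 _ := by
  refine GRep.hom_ext fun p => ?_
  change P.act p (U.u 0 p) = p
  rw [U.map_zero, P.act_one]

/-- The homomorphism `n ↦ U_n` to the automorphism group of the representation. -/
def autHom : Multiplicative (Fin k → ℤ) →* Aut (GRep.mk P φ) where
  toFun n :=
    { hom := U.hom n.toAdd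
      inv := U.hom (-n.toAdd)
      hom_inv_id := by rw [hom_comp_hom, neg_add_cancel, hom_zero]
      inv_hom_id := by rw [hom_comp_hom, add_neg_cancel, hom_zero] }
  map_one' := Iso.ext U.hom_zero
  map_mul' n n' := Iso.ext (U.hom_comp_hom n'.toAdd n.toAdd).symm

theorem autFun_autHom (n : Multiplicative (Fin k → ℤ)) (p : P.carrier) :
    GRep.autFun (U.autHom n) p = P.act p (U.u n.toAdd p) := rfl

theorem isUnipotentAut_autHom (n : Multiplicative (Fin k → ℤ)) :
    IsUnipotentAut R (U.autHom n) := by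
  intro p h e
  rw [autFun_autHom] at e
  rw [← P.act_injective p e]
  exact U.unipotent _ _

theorem twist_intertwines {P' : PrincipalBundle.{w} E X F H} {φ' : RepOn 𝒢.toHolLieGroupoid P'}
    (U' : UnipotentFamily R φ') (f : GRep.mk P φ ⟶ GRep.mk P' φ')
    (hu : ∀ n p, U'.u n (f.map.toFun p) = U.u n p) {g : G} {q p : P.carrier}
    (h : U.twist.toFun g = P.arrow q p) :
    U'.twist.toFun g = P'.arrow (f.map.toFun q) (f.map.toFun p) := by
  obtain ⟨q₀, hq₀⟩ := φ.exists_eq_arrow_of_src (RepOn.proj_eq_src h)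
  rw [U.twist_eq hq₀] at h
  have hcocycle : U'.frameCocycle g (f.map.toFun q₀) = U.frameCocycle g q₀ := by
    refine U'.frameCocycle_eq ?_
    simp only [hu]
    exact U.isExpLog_frameCocycle g q₀
  have hq : f.map.toFun q = P'.act (f.map.toFun q₀) (U.frameCocycle g q₀) := by
    rw [← PrincipalBundle.arrow_left_injective p h]
    exact f.map.toFun_act q₀ _
  rw [U'.twist_eq (f.intertwines g q₀ p hq₀), hcocycle, hq]

end UnipotentFamily

namespace RepOn

variable {P : PrincipalBundle.{w} E X F H} (φ : RepOn 𝒢.toHolLieGroupoid P)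

theorem frameMonodromy_map {P' : PrincipalBundle.{w} E X F H}
    {φ' : RepOn 𝒢.toHolLieGroupoid P'} (f : GRep.mk P φ ⟶ GRep.mk P' φ') (n : Fin k → ℤ)
    (p : P.carrier) : φ'.frameMonodromy n (f.map.toFun p) = φ.frameMonodromy n p := by
  have hproj : P'.proj (f.map.toFun p) = P.proj p := f.map.proj_toFun p
  have hact : f.map.toFun (P.act p (φ.frameMonodromy n p)) =
      P'.act (f.map.toFun p) (φ.frameMonodromy n p) := f.map.toFun_act _ _
  refine frameMonodromy_eq ?_
  rw [hproj, ← hact]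
  exact f.intertwines _ _ _ (φ.monodromy_eq n p)

variable [LieGroup 𝓘(ℂ, F) ω H]

variable (R) in
/-- The representation `φ_s = σ_U φ`. -/
def semisimplePart : RepOn 𝒢.toHolLieGroupoid P := (φ.unipotentMonodromy R).twist

variable (R) in
/-- The unipotent components `U_n` of the monodromy of `φ`, as automorphisms of `φ_s`. -/
def unipotentFamily : UnipotentFamily R (φ.semisimplePart R) :=
  (φ.unipotentMonodromy R).transfer (φ.unipotentMonodromy R) (φ.unipotentMonodromy R).commute

theorem monodromy_semisimplePart (n : Fin k → ℤ) (p : P.carrier) :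
    monodromy 𝒢 (φ.semisimplePart R) n (P.proj p) =
      P.arrow (P.act p (R.semisimplePart (φ.frameMonodromy n p))) p := by
  have hs : φ.frameMonodromy n p * (R.unipotentPart (φ.frameMonodromy n p))⁻¹ =
      R.semisimplePart (φ.frameMonodromy n p) :=
    mul_inv_eq_of_eq_mul (R.isJordanChevalley_parts _).2.2.1
  rw [← hs]
  exact (φ.unipotentMonodromy R).monodromy_twist (φ.monodromy_eq n p)

theorem hasSemisimpleMonodromy_semisimplePart :
    HasSemisimpleMonodromy 𝒢 R (φ.semisimplePart R) := by
  intro n p m h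
  rw [φ.monodromy_semisimplePart n p] at h
  rw [← P.act_injective p (PrincipalBundle.arrow_left_injective p h)]
  exact (R.isJordanChevalley_parts _).1

end RepOn

namespace JC

theorem hom_heq {A A' B B' : JC.{w} 𝒢 R} (hA : A = A') (hB : B = B') {f : A ⟶ B}
    {f' : A' ⟶ B'} (h : HEq f.map.map f'.map.map) : HEq f f' := by
  subst hA hB
  exact heq_of_eq (JC.Hom.ext (GRep.Hom.ext (eq_of_heq h)))

theorem obj_ext {P : PrincipalBundle.{w} E X F H} {φ φ' : RepOn 𝒢.toHolLieGroupoid P}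
    {hs : HasSemisimpleMonodromy 𝒢 R φ} {hs' : HasSemisimpleMonodromy 𝒢 R φ'}
    {U : Multiplicative (Fin k → ℤ) →* Aut (GRep.mk P φ)}
    {U' : Multiplicative (Fin k → ℤ) →* Aut (GRep.mk P φ')}
    {hU : ∀ n, IsUnipotentAut R (U n)} {hU' : ∀ n, IsUnipotentAut R (U' n)} (hφ : φ = φ')
    (h : ∀ n p, GRep.autFun (U n) p = GRep.autFun (U' n) p) :
    JC.mk ⟨P, φ⟩ hs U hU = JC.mk ⟨P, φ'⟩ hs' U' hU' := by
  subst hφ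
  obtain rfl : U = U' := MonoidHom.ext fun n => Iso.ext (GRep.hom_ext (h n))
  rfl

variable [LieGroup 𝓘(ℂ, F) ω H]

/-- The automorphisms `U_n` of a Jordan–Chevalley triple, read in frames. -/
def family (J : JC.{w} 𝒢 R) : UnipotentFamily R J.rep.φ where
  u n := GRep.autFrame (J.U (.ofAdd n))
  map_add n n' p := by rw [ofAdd_add, map_mul, GRep.autFrame_mul]
  conj n := GRep.autFrame_act _
  holomorphic n := GRep.contMDiff_autFrame _
  invariant n _ _ _ := GRep.autFrame_invariant _
  unipotent n p := J.unipotent _ p _ (GRep.act_autFrame _ p).symm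

theorem family_map {J J' : JC.{w} 𝒢 R} (f : J ⟶ J') (n : Fin k → ℤ) (p : J.rep.P.carrier) :
    J'.family.u n (f.map.map.toFun p) = J.family.u n p := by
  have h : f.map.map.toFun (GRep.autFun (J.U (.ofAdd n)) p) =
      GRep.autFun (J'.U (.ofAdd n)) (f.map.map.toFun p) :=
    congrArg (fun a : J.rep ⟶ J'.rep => a.map.toFun p) (f.intertwines (.ofAdd n))
  refine GRep.autFrame_eq ?_
  rw [← h, ← GRep.act_autFrame]
  exact f.map.map.toFun_act p _

theorem autFun_inv (J : JC.{w} 𝒢 R) (n : Fin k → ℤ) (p : J.rep.P.carrier) :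
    GRep.autFun (J.U (.ofAdd n))⁻¹ p = J.rep.P.act p (J.family.inv.u n p) := by
  rw [← map_inv, ← ofAdd_neg, ← GRep.act_autFrame]
  exact congrArg _ (map_inv (J.family.monoidHom p) (.ofAdd n))

theorem commute_frameMonodromy_family (J : JC.{w} 𝒢 R) (n : Fin k → ℤ) (p : J.rep.P.carrier) :
    Commute (J.rep.φ.frameMonodromy n p) (J.family.u n p) := by
  have h := J.family.invariant n _ _ _ (J.rep.φ.monodromy_eq n p)
  rw [J.family.conj, mul_assoc, inv_mul_eq_iff_eq_mul] at h
  exact h.symm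

theorem frameMonodromy_twist_inv (J : JC.{w} 𝒢 R) (n : Fin k → ℤ) (p : J.rep.P.carrier) :
    J.family.inv.twist.frameMonodromy n p = J.rep.φ.frameMonodromy n p * J.family.u n p := by
  have h := RepOn.frameMonodromy_eq (J.family.inv.monodromy_twist (J.rep.φ.monodromy_eq n p))
  rwa [show (J.family.inv.u n p)⁻¹ = J.family.u n p from inv_inv _] at h

theorem unipotentMonodromy_twist_inv (J : JC.{w} 𝒢 R) (n : Fin k → ℤ) (p : J.rep.P.carrier) :
    (J.family.inv.twist.unipotentMonodromy R).u n p = J.family.u n p := by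
  have hJC : R.IsJordanChevalley (J.family.inv.twist.frameMonodromy n p)
      (J.rep.φ.frameMonodromy n p) (J.family.u n p) :=
    ⟨J.semisimple n p _ (J.rep.φ.monodromy_eq n p), J.family.unipotent n p,
      J.frameMonodromy_twist_inv n p, J.commute_frameMonodromy_family n p⟩
  exact hJC.unipotentPart_eq

end JC

variable [LieGroup 𝓘(ℂ, F) ω H] (𝒢 R)

/-- The functor `T (P, φ) = (P, φ_s, U)`. -/
def jordanFunctor : GRep.{w} F H 𝒢.toHolLieGroupoid ⥤ JC.{w} 𝒢 R where
  obj A := ⟨⟨A.P, A.φ.semisimplePart R⟩, A.φ.hasSemisimpleMonodromy_semisimplePart,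
    (A.φ.unipotentFamily R).autHom, (A.φ.unipotentFamily R).isUnipotentAut_autHom⟩
  map {A B} f :=
    have hu : ∀ n p, (B.φ.unipotentMonodromy R).u n (f.map.toFun p) =
        (A.φ.unipotentMonodromy R).u n p := fun n p =>
      congrArg R.unipotentPart (A.φ.frameMonodromy_map f n p)
    JC.Hom.mk
      (GRep.Hom.mk f.map fun _ _ _ h =>
        (A.φ.unipotentMonodromy R).twist_intertwines (B.φ.unipotentMonodromy R) f hu h)
      (fun n => GRep.hom_ext fun p => by
        change f.map.toFun (A.P.act p ((A.φ.unipotentMonodromy R).u n.toAdd p)) =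
          B.P.act (f.map.toFun p) ((B.φ.unipotentMonodromy R).u n.toAdd (f.map.toFun p))
        rw [hu]
        exact f.map.toFun_act _ _)
  map_id _ := rfl
  map_comp _ _ := rfl

/-- The functor `(P, φ_s, U) ↦ (P, σ_{U⁻¹} φ_s)`, inverse to `T`. -/
def jordanInverse : JC.{w} 𝒢 R ⥤ GRep.{w} F H 𝒢.toHolLieGroupoid where
  obj J := ⟨J.rep.P, J.family.inv.twist⟩
  map {J J'} f := GRep.Hom.mk f.map.map fun _ _ _ h =>
    J.family.inv.twist_intertwines J'.family.inv f.map
      (fun n p => congrArg (·⁻¹) (JC.family_map f n p)) h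
  map_id _ := rfl
  map_comp _ _ := rfl

theorem jordanFunctor_comp_jordanInverse :
    jordanFunctor.{w} 𝒢 R ⋙ jordanInverse 𝒢 R = 𝟭 _ := by
  have hobj : ∀ A, (jordanFunctor.{w} 𝒢 R ⋙ jordanInverse 𝒢 R).obj A = A := by
    rintro ⟨P, φ⟩
    refine congrArg (GRep.mk P) (UnipotentFamily.twist_twist_of_inv _ _ fun n p => ?_)
    exact congrArg (·⁻¹) (GRep.autFrame_eq rfl)
  exact Functor.hext hobj fun A B f => GRep.hom_heq (hobj A) (hobj B) HEq.rfl

theorem jordanInverse_comp_jordanFunctor :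
    jordanInverse.{w} 𝒢 R ⋙ jordanFunctor 𝒢 R = 𝟭 _ := by
  have hobj : ∀ J, (jordanInverse.{w} 𝒢 R ⋙ jordanFunctor 𝒢 R).obj J = J := by
    intro J
    refine JC.obj_ext (P := J.rep.P) (φ' := J.rep.φ) (hs' := J.semisimple) (U' := J.U)
      (hU' := J.unipotent) ?_ fun n p => ?_
    · refine UnipotentFamily.twist_twist_of_inv J.family.inv _ fun n p => ?_
      exact (J.unipotentMonodromy_twist_inv n p).trans (inv_inv _).symm
    · refine Eq.trans ?_ (GRep.act_autFrame (J.U n) p)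
      exact congrArg (J.rep.P.act p) (J.unipotentMonodromy_twist_inv n.toAdd p)
  exact Functor.hext hobj fun J J' f => JC.hom_heq (hobj J) (hobj J') HEq.rfl

end Functors

end JCDec

end

theorem mainTheorem3_general
    {E EG F X G H : Type*}
    [NormedAddCommGroup E] [NormedSpace ℂ E]
    [NormedAddCommGroup EG] [NormedSpace ℂ EG]
    [NormedAddCommGroup F] [NormedSpace ℂ F]
    [TopologicalSpace X] [ChartedSpace E X]
    [TopologicalSpace G] [ChartedSpace EG G]
    [TopologicalSpace H] [ChartedSpace F H] [Group H] [LieGroup 𝓘(ℂ, F) ω H]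
    {k : ℕ} [MulAction (Fin k → ℂˣ) X]
    (𝒢 : HomogeneousGroupoid E EG X G k) (R : ReductiveGroup F H) :
    ∃ (T : GRep.{w} F H 𝒢.toHolLieGroupoid ⥤ JC.{w} 𝒢 R)
      (T' : JC.{w} 𝒢 R ⥤ GRep.{w} F H 𝒢.toHolLieGroupoid),
      T ⋙ T' = 𝟭 _ ∧ T' ⋙ T = 𝟭 _ ∧
      T ⋙ JC.forget = GRep.forget ∧
      (∀ (P : PrincipalBundle.{w} E X F H) (φ : RepOn 𝒢.toHolLieGroupoid P),
        ∃ (φs : RepOn 𝒢.toHolLieGroupoid P) (hs : HasSemisimpleMonodromy 𝒢 R φs)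
          (U : Multiplicative (Fin k → ℤ) →* Aut (GRep.mk P φs))
          (hU : ∀ n, IsUnipotentAut R (U n)),
          T.obj ⟨P, φ⟩ = ⟨⟨P, φs⟩, hs, U, hU⟩ ∧
          (∀ (n : Fin k → ℤ) (p : P.carrier), ∃ m s u : H,
            R.IsJordanChevalley m s u ∧
            monodromy 𝒢 φ n (P.proj p) = P.arrow (P.act p m) p ∧
            monodromy 𝒢 φs n (P.proj p) = P.arrow (P.act p s) p ∧
            GRep.autFun (U (Multiplicative.ofAdd n)) p = P.act p u) ∧
          IsTwist 𝒢 R (fun n => GRep.autFun (U (Multiplicative.ofAdd n))) φ φs) ∧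
      (∀ J : JC.{w} 𝒢 R, ∃ φ : RepOn 𝒢.toHolLieGroupoid J.rep.P,
        T'.obj J = ⟨J.rep.P, φ⟩ ∧
        IsTwist 𝒢 R (fun n => GRep.autFun (J.U (Multiplicative.ofAdd n))⁻¹) J.rep.φ φ) := by
  refine ⟨jordanFunctor 𝒢 R, jordanInverse 𝒢 R, jordanFunctor_comp_jordanInverse 𝒢 R,
    jordanInverse_comp_jordanFunctor 𝒢 R, rfl, fun P φ => ?_, fun J => ?_⟩
  · refine ⟨φ.semisimplePart R, φ.hasSemisimpleMonodromy_semisimplePart,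
      (φ.unipotentFamily R).autHom, (φ.unipotentFamily R).isUnipotentAut_autHom, rfl,
      fun n p => ?_, ?_⟩
    · exact ⟨φ.frameMonodromy n p, R.semisimplePart _, R.unipotentPart _,
        R.isJordanChevalley_parts _, φ.monodromy_eq n p, φ.monodromy_semisimplePart n p, rfl⟩
    · exact (φ.unipotentMonodromy R).isTwist fun n q => rfl
  · exact ⟨J.family.inv.twist, rfl, J.family.inv.isTwist fun n q => J.autFun_inv n q⟩

theorem mainTheorem3
    {E EG F X G H : Type*}
    [NormedAddCommGroup E] [NormedSpace ℂ E] [FiniteDimensional ℂ E]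
    [NormedAddCommGroup EG] [NormedSpace ℂ EG] [FiniteDimensional ℂ EG]
    [NormedAddCommGroup F] [NormedSpace ℂ F] [FiniteDimensional ℂ F]
    [TopologicalSpace X] [ChartedSpace E X] [IsManifold 𝓘(ℂ, E) ω X]
    [TopologicalSpace G] [ChartedSpace EG G] [IsManifold 𝓘(ℂ, EG) ω G]
    [TopologicalSpace H] [ChartedSpace F H] [Group H] [LieGroup 𝓘(ℂ, F) ω H] [ConnectedSpace H]
    {k : ℕ} [MulAction (Fin k → ℂˣ) X]
    (𝒢 : HomogeneousGroupoid E EG X G k) (R : ReductiveGroup F H) :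
    ∃ (T : GRep.{w} F H 𝒢.toHolLieGroupoid ⥤ JC.{w} 𝒢 R)
      (T' : JC.{w} 𝒢 R ⥤ GRep.{w} F H 𝒢.toHolLieGroupoid),
      -- `T` and `T'` are mutually inverse, so that `T` is an isomorphism of categories
      T ⋙ T' = 𝟭 _ ∧ T' ⋙ T = 𝟭 _ ∧
      -- `T` is the identity on underlying bundles and bundle maps
      T ⋙ JC.forget = GRep.forget ∧
      -- `T (P, φ) = (P, σ_U φ, U)` with `U` the unipotent part of the monodromy `M` of `φ`,
      -- and the monodromy of `σ_U φ` is the semisimple part of `M`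
      (∀ (P : PrincipalBundle.{w} E X F H) (φ : RepOn 𝒢.toHolLieGroupoid P),
        ∃ (φs : RepOn 𝒢.toHolLieGroupoid P) (hs : HasSemisimpleMonodromy 𝒢 R φs)
          (U : Multiplicative (Fin k → ℤ) →* Aut (GRep.mk P φs))
          (hU : ∀ n, IsUnipotentAut R (U n)),
          T.obj ⟨P, φ⟩ = ⟨⟨P, φs⟩, hs, U, hU⟩ ∧
          (∀ (n : Fin k → ℤ) (p : P.carrier), ∃ m s u : H,
            R.IsJordanChevalley m s u ∧
            monodromy 𝒢 φ n (P.proj p) = P.arrow (P.act p m) p ∧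
            monodromy 𝒢 φs n (P.proj p) = P.arrow (P.act p s) p ∧
            GRep.autFun (U (Multiplicative.ofAdd n)) p = P.act p u) ∧
          IsTwist 𝒢 R (fun n => GRep.autFun (U (Multiplicative.ofAdd n))) φ φs) ∧
      -- `T' (P, φ_s, U) = (P, σ_{U⁻¹} φ_s)`
      (∀ J : JC.{w} 𝒢 R, ∃ φ : RepOn 𝒢.toHolLieGroupoid J.rep.P,
        T'.obj J = ⟨J.rep.P, φ⟩ ∧
        IsTwist 𝒢 R (fun n => GRep.autFun (J.U (Multiplicative.ofAdd n))⁻¹) J.rep.φ φ) :=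
  mainTheorem3_general 𝒢 R
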